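/- Notation. Let $\mathcal W$ be the set of all functions $w_*:[0,\infty)\to\mathbb R$ such that: $w_*\in C^\infty(0,\infty)$ and $w_*$ is regularly varying of some index $\alpha\in[0,1)$, i.e. $w_*$ is measurable and positive on $(0,\infty)$ and $\lim_{t\to\infty}w_*(tx)/w_*(t)=x^\alpha$ for all $x>0$; $w_*\ge1$; $w_*$ is strictly increasing; $\lim_{t\to\infty}(w_*(t)-M\log t)=\infty$ for every $M\in\mathbb R$; the one-sided derivative $w_*'(0)$ exists and equals $0$; and there is a number $\tau$ with $w_*''(x)<0$ for all $x>\tau$. Fix a window $\rho\in C^\infty(\mathbb R^n)$ with values in $[0,1]$, vanishing outside $[-1,1]^n$ and equal to $1$ on $[-\frac12,\frac12]^n$. For $k\in\mathbb Z^n$ put $\sigma_k(\xi)=\rho(\xi-k)\big(\sum_{j\in\mathbb Z^n}\rho(\xi-j)\big)^{-1}$ and $\Box_k f=\mathcal F^{-1}(\sigma_k\,\mathcal F f)$ for $f\in\mathcal S'(\mathbb R^n)$, where $\mathcal F f(\xi)=(2\pi)^{-n/2}\int_{\mathbb R^n} f(x)e^{-ix\cdot\xi}\,dx$. For $1\le p,q\le\infty$,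 the space $\mathcal M^{w_*}_{p,q}(\mathbb R^n)$ consists of all $f\in L^p(\mathbb R^n)$ (complex-valued) with $$\|f\|_{\mathcal M^{w_*}_{p,q}}=\Big(\sum_{k\in\mathbb Z^n}e^{q\,w_*(|k|)}\,\|\Box_kf\|_{L^p}^q\Big)^{1/q}<\infty$$ (a supremum over $k$ if $q=\infty$); it carries the topology of this norm. For $s\ge0$ let $\varphi^*(s)=\sup_{y>0}\big(sy-w_*(e^y)\big)$. For $K\subset\mathbb R^n$ compact, $m\in\mathbb N$, $m\ge 1$, and $f\in C^\infty(\mathbb R^n)$ put $$\|f\|_{K,m}=\sup_{x\in K,\ \alpha\in\mathbb N_0^n}\frac{|\partial^\alpha f(x)|}{e^{\frac1m\varphi^*(m|\alpha|)}}.$$ The Roumieu class of $w_*$-ultradifferentiable functions is $$\mathcal E_{\{w_*\}}(\mathbb R^n)=\{f\in C^\infty(\mathbb R^n):\ \forall K\subset\mathbb R^n\text{ compact }\exists m\ge1:\ \|f\|_{K,m}<\infty\},$$ with its usual topology: the projective limit, over compact $K$, of the locally convex inductive limits, over $m$, of the seminormed spaces $\{f\in C^\infty(\mathbb R^n):\|f\|_{K,m}<\infty\}$.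 Proposition. Let $1\le p,q\le\infty$, let $w_*\in\mathcal W$, and let $\rho$ be any window as above. Then there is a continuous embedding $$\mathcal M^{w_*}_{p,q}(\mathbb R^n)\hookrightarrow\mathcal E_{\{w_*\}}(\mathbb R^n).$$ That is, every $f\in\mathcal M^{w_*}_{p,q}(\mathbb R^n)$ coincides almost everywhere with a function $\iota f\in\mathcal E_{\{w_*\}}(\mathbb R^n)$, and the map $\iota$ is linear, injective and continuous. -/

import Mathlib

open MeasureTheory Filter Topology Set TopologicalSpace
open scoped ContDiff SchwartzMap

noncomputable section

namespace UltraModulation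

/-- The Euclidean space `ℝⁿ`. -/
abbrev Rn (n : ℕ) : Type := EuclideanSpace ℝ (Fin n)

/-! ### Admissible weights -/

/-- `f : (0,∞) → (0,∞)` is measurable and regularly varying of index `α`
(slowly varying if `α = 0`). Only the values of `f` on `(0,∞)` matter. -/
structure IsRegularlyVarying (f : ℝ → ℝ) (α : ℝ) : Prop where
  measurable : Measurable ((Ioi (0 : ℝ)).domRestrict f)
  pos : ∀ t, 0 < t → 0 < f t
  tendsto : ∀ x, 0 < x → Tendsto (fun t => f (t * x) / f t) atTop (𝓝 (x ^ α))

/-- The class `𝓦(ℝ)` of admissible weight functions `w : [0,∞) → ℝ`; a weight is represented by a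
function on `ℝ`, of which only the values on `[0,∞)` matter. -/
structure IsAdmissibleWeight (w : ℝ → ℝ) : Prop where
  contDiffOn : ContDiffOn ℝ ∞ w (Ioi 0)
  regularlyVarying : ∃ α : ℝ, 0 ≤ α ∧ α < 1 ∧ IsRegularlyVarying w α
  one_le : ∀ x, 0 ≤ x → 1 ≤ w x
  strictMonoOn : StrictMonoOn w (Ici 0)
  tendsto_sub_log : ∀ M : ℝ, Tendsto (fun t => w t - M * Real.log t) atTop atTop
  deriv_zero : HasDerivWithinAt w 0 (Ici 0) 0
  deriv_two_neg : ∃ τ : ℝ, ∀ x, τ < x → iteratedDeriv 2 w x < 0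

/-- The set `𝓦(ℝ)` as a type. -/
abbrev AdmissibleWeight : Type := {w : ℝ → ℝ // IsAdmissibleWeight w}

/-! ### Seminorms obtained from finite `[0,∞]`-valued seminorms -/

/-- A finite function `N : V → [0,∞]` with the algebraic properties of a seminorm, viewed as
a (real-valued) seminorm. -/
def seminormOfENNReal {V : Type*} [AddCommGroup V] [Module ℂ V] (N : V → ENNReal)
    (zero : N 0 = 0) (add_le : ∀ f g, N (f + g) ≤ N f + N g)
    (smul_le : ∀ (c : ℂ) f, N (c • f) ≤ ‖c‖ₑ * N f) (fin : ∀ f, N f ≠ ⊤) : Seminorm ℂ V :=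
  Seminorm.ofSMulLE (fun f => (N f).toReal) (by simp [zero])
    (fun f g => by
      rw [← ENNReal.toReal_add (fin f) (fin g)]
      exact ENNReal.toReal_mono (ENNReal.add_ne_top.2 ⟨fin f, fin g⟩) (add_le f g))
    (fun c f => by
      have h := ENNReal.toReal_mono
        (ENNReal.mul_ne_top (by simp) (fin f)) (smul_le c f)
      simpa [ENNReal.toReal_mul] using h)

/-! ### Uniform decomposition and modulation spaces -/

/-- The lattice point `k ∈ ℤⁿ` as an element of `ℝⁿ`. -/
def latticePoint {n : ℕ} (k : Fin n → ℤ) : Rn n := WithLp.toLp 2 (fun i => (k i : ℝ))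

/-- `ρ : ℝⁿ → [0,1]` is smooth, supported in the cube `[-1,1]ⁿ`, and equal to `1` on
`[-1/2,1/2]ⁿ`. -/
structure IsWindow {n : ℕ} (ρ : Rn n → ℝ) : Prop where
  contDiff : ContDiff ℝ ∞ ρ
  mem_Icc : ∀ ξ, ρ ξ ∈ Icc (0 : ℝ) 1
  support_subset : Function.support ρ ⊆ {ξ | ∀ i, |ξ i| ≤ 1}
  eq_one : ∀ ξ : Rn n, (∀ i, |ξ i| ≤ 1 / 2) → ρ ξ = 1

/-- The uniform decomposition of unity `σ_k(ξ) = ρ(ξ - k) / ∑_j ρ(ξ - j)`; the sum is locally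
finite and at least `1` when `ρ` is a window. -/
def uniformDecomp {n : ℕ} (ρ : Rn n → ℝ) (k : Fin n → ℤ) (ξ : Rn n) : ℝ :=
  ρ (ξ - latticePoint k) / ∑' j : Fin n → ℤ, ρ (ξ - latticePoint j)

/-- The uniform decomposition operator `□_k = 𝓕⁻¹ (σ_k 𝓕 ·)` on tempered distributions, for the
Fourier transform `(2π)^(-n/2) ∫ f(x) exp(-i x·ξ) dx`. As Mathlib's transform has the kernel
`exp(-2πi x·ξ)`, the multiplier in Mathlib's normalization is `ξ ↦ σ_k(2πξ)`. -/
def boxOp {n : ℕ} (ρ : Rn n → ℝ) (k : Fin n → ℤ) : 𝓢'(Rn n, ℂ) →L[ℂ] 𝓢'(Rn n, ℂ) :=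
  TemperedDistribution.fourierMultiplierCLM ℂ
    (fun ξ => (uniformDecomp ρ k ((2 * Real.pi) • ξ) : ℂ))

variable {n : ℕ} {p : ENNReal} [Fact (1 ≤ p)]

/-- The `L^p` norm of a tempered distribution: the norm of the `L^p` function that represents it,
and `∞` if there is none. -/
def distLpNorm (p : ENNReal) [Fact (1 ≤ p)] (u : 𝓢'(Rn n, ℂ)) : ENNReal :=
  ⨅ (g : Lp ℂ p (volume : Measure (Rn n)))
    (_ : Lp.toTemperedDistributionCLM ℂ (volume : Measure (Rn n)) p g = u), ‖g‖ₑ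

lemma distLpNorm_zero : distLpNorm p (0 : 𝓢'(Rn n, ℂ)) = 0 := by
  refine le_antisymm (iInf₂_le_of_le 0 (map_zero _) (by simp)) bot_le

lemma distLpNorm_add_le (u v : 𝓢'(Rn n, ℂ)) :
    distLpNorm p (u + v) ≤ distLpNorm p u + distLpNorm p v := by
  refine ENNReal.le_iInf₂_add_iInf₂ fun g hg h hh => ?_
  exact iInf₂_le_of_le (g + h) (by rw [map_add, hg, hh]) (enorm_add_le _ _)

lemma distLpNorm_smul_le (c : ℂ) (u : 𝓢'(Rn n, ℂ)) :
    distLpNorm p (c • u) ≤ ‖c‖ₑ * distLpNorm p u := by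
  rcases eq_or_ne c 0 with rfl | hc
  · have h : (0 : ℂ) • u = 0 := zero_smul ℂ u
    rw [h, distLpNorm_zero]
    exact bot_le
  · have h0 : ‖c‖ₑ ≠ 0 := by simpa using hc
    have h1 : ‖c‖ₑ ≠ ⊤ := by simp
    simp only [distLpNorm, ENNReal.mul_iInf_of_ne h0 h1]
    refine le_iInf₂ fun g hg => ?_
    exact iInf₂_le_of_le (c • g) (by rw [map_smul, hg]) (enorm_smul c g).le

/-- The `[0,∞]`-valued norm
`(∑_{k ∈ ℤⁿ} exp(q w(|k|)) ‖□_k f‖_{L^p}^q)^{1/q}` of `f ∈ L^p(ℝⁿ)`, that is, the `ℓ^q` norm over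
`ℤⁿ` of `exp(w(|k|)) ‖□_k f‖_{L^p}` (a supremum if `q = ∞`). -/
def modENorm (q : ENNReal) (w : ℝ → ℝ) (ρ : Rn n → ℝ)
    (f : Lp ℂ p (volume : Measure (Rn n))) : ENNReal :=
  eLpNorm (fun k : Fin n → ℤ => ENNReal.ofReal (Real.exp (w ‖latticePoint k‖)) *
    distLpNorm p (boxOp ρ k (Lp.toTemperedDistributionCLM ℂ volume p f))) q Measure.count

variable (q : ENNReal) (w : ℝ → ℝ) (ρ : Rn n → ℝ)

lemma modENorm_zero : modENorm q w ρ (0 : Lp ℂ p (volume : Measure (Rn n))) = 0 := by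
  simp only [modENorm, map_zero, distLpNorm_zero, mul_zero]
  exact eLpNorm_zero'

lemma modENorm_add_le (hq : 1 ≤ q) (f g : Lp ℂ p (volume : Measure (Rn n))) :
    modENorm q w ρ (f + g) ≤ modENorm q w ρ f + modENorm q w ρ g := by
  refine le_trans (eLpNorm_mono_enorm fun k => ?_)
    (eLpNorm_add_le (measurable_of_countable _).aestronglyMeasurable
      (measurable_of_countable _).aestronglyMeasurable hq)
  simp only [map_add, Pi.add_apply, enorm_eq_self]
  rw [← mul_add]
  gcongr
  exact distLpNorm_add_le _ _

lemma modENorm_smul_le (c : ℂ) (f : Lp ℂ p (volume : Measure (Rn n))) :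
    modENorm q w ρ (c • f) ≤ ‖c‖ₑ * modENorm q w ρ f := by
  have h := eLpNorm_le_nnreal_smul_eLpNorm_of_ae_le_mul' (c := ‖c‖₊) (p := q)
    (μ := (Measure.count : Measure (Fin n → ℤ)))
    (f := fun k : Fin n → ℤ => ENNReal.ofReal (Real.exp (w ‖latticePoint k‖)) *
      distLpNorm p (boxOp ρ k (Lp.toTemperedDistributionCLM ℂ volume p (c • f))))
    (g := fun k : Fin n → ℤ => ENNReal.ofReal (Real.exp (w ‖latticePoint k‖)) *
      distLpNorm p (boxOp ρ k (Lp.toTemperedDistributionCLM ℂ volume p f)))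
    (Eventually.of_forall fun k => by
      simp only [map_smul, enorm_eq_self]
      rw [mul_left_comm]
      gcongr
      exact distLpNorm_smul_le _ _)
  exact h

/-- The modulation space `𝓜^w_{p,q}(ℝⁿ)` as a subspace of `L^p(ℝⁿ)`. -/
def modulationSubmodule (n : ℕ) (p : ENNReal) [Fact (1 ≤ p)] (q : ENNReal) [Fact (1 ≤ q)]
    (w : ℝ → ℝ) (ρ : Rn n → ℝ) : Submodule ℂ (Lp ℂ p (volume : Measure (Rn n))) where
  carrier := {f | modENorm q w ρ f < ⊤}
  zero_mem' := by simp [modENorm_zero]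
  add_mem' {f g} hf hg :=
    (modENorm_add_le q w ρ Fact.out f g).trans_lt (ENNReal.add_lt_top.2 ⟨hf, hg⟩)
  smul_mem' c f hf :=
    (modENorm_smul_le q w ρ c f).trans_lt (ENNReal.mul_lt_top (by simp) hf)

/-- The modulation space `𝓜^w_{p,q}(ℝⁿ)`: all `f ∈ L^p(ℝⁿ)` with finite norm. It carries its own
norm, not the one of `L^p`. -/
def ModulationSpace (n : ℕ) (p : ENNReal) [Fact (1 ≤ p)] (q : ENNReal) [Fact (1 ≤ q)]
    (w : ℝ → ℝ) (ρ : Rn n → ℝ) : Type :=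
  ↥(modulationSubmodule n p q w ρ)

namespace ModulationSpace

variable {q w ρ} [Fact (1 ≤ q)]

instance : AddCommGroup (ModulationSpace n p q w ρ) :=
  inferInstanceAs (AddCommGroup ↥(modulationSubmodule n p q w ρ))

instance : Module ℂ (ModulationSpace n p q w ρ) :=
  inferInstanceAs (Module ℂ ↥(modulationSubmodule n p q w ρ))

/-- The element of `L^p(ℝⁿ)` underlying `f ∈ 𝓜^w_{p,q}(ℝⁿ)`. -/
def toLp (f : ModulationSpace n p q w ρ) : Lp ℂ p (volume : Measure (Rn n)) := f.1

/-- The norm of `𝓜^w_{p,q}(ℝⁿ)` as a seminorm. -/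
def normSeminorm (n : ℕ) (p : ENNReal) [Fact (1 ≤ p)] (q : ENNReal) [Fact (1 ≤ q)]
    (w : ℝ → ℝ) (ρ : Rn n → ℝ) : Seminorm ℂ (ModulationSpace n p q w ρ) :=
  seminormOfENNReal (fun f => modENorm q w ρ f.toLp) (modENorm_zero q w ρ)
    (fun f g => modENorm_add_le q w ρ Fact.out f.toLp g.toLp)
    (fun c f => modENorm_smul_le q w ρ c f.toLp) (fun f => f.2.ne)

instance : SeminormedAddCommGroup (ModulationSpace n p q w ρ) :=
  (normSeminorm n p q w ρ).toAddGroupSeminorm.toSeminormedAddCommGroup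

lemma norm_def (f : ModulationSpace n p q w ρ) : ‖f‖ = (modENorm q w ρ f.toLp).toReal := rfl

instance : NormedSpace ℂ (ModulationSpace n p q w ρ) where
  norm_smul_le c f := (map_smul_eq_mul (normSeminorm n p q w ρ) c f).le

end ModulationSpace

/-! ### Ultradifferentiable functions of Roumieu type -/

/-- The partial derivative `∂^α f(x)` of a smooth function `f`, for a multi-index `α ∈ ℕⁿ`:
the derivative of order `|α| = ∑ αᵢ` evaluated at `αᵢ` copies of the basis vector `eᵢ` for
every `i`. -/
def multiDeriv (α : Fin n → ℕ) (f : Rn n → ℂ) (x : Rn n) : ℂ :=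
  iteratedFDeriv ℝ (∑ i, α i) f x
    (fun j => EuclideanSpace.single (finSigmaFinEquiv.symm j).1 (1 : ℝ))

/-- `φ*(s) = sup_{y > 0} (s y - w(exp y))`, the Young conjugate of `y ↦ w(exp y)`. -/
def youngConj (w : ℝ → ℝ) (s : ℝ) : ℝ := ⨆ y : Ioi (0 : ℝ), (s * y - w (Real.exp y))

/-- `sup_{x ∈ K, α ∈ ℕⁿ} |∂^α f(x)| / exp((1/m) φ*(m|α|))`, as an element of `[0,∞]`. -/
def roumieuENorm (w : ℝ → ℝ) (K : Compacts (Rn n)) (m : ℕ+) (f : Rn n → ℂ) : ENNReal :=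
  ⨆ (x : Rn n) (_ : x ∈ K) (α : Fin n → ℕ),
    ENNReal.ofReal (‖multiDeriv α f x‖ /
      Real.exp (1 / (m : ℝ) * youngConj w ((m : ℝ) * ((∑ i, α i : ℕ) : ℝ))))

variable {w}

lemma IsAdmissibleWeight.bddAbove (hw : IsAdmissibleWeight w) {s : ℝ} (hs : 0 ≤ s) :
    BddAbove (range fun y : Ioi (0 : ℝ) => s * y - w (Real.exp y)) := by
  obtain ⟨T, hT⟩ := eventually_atTop.1 ((hw.tendsto_sub_log s).eventually_ge_atTop 0)
  refine ⟨max 0 (s * T), ?_⟩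
  rintro _ ⟨⟨y, hy⟩, rfl⟩
  have hy : 0 < y := hy
  dsimp only
  rcases le_or_gt T (Real.exp y) with h | h
  · have := hT _ h
    rw [Real.log_exp] at this
    exact le_max_of_le_left (by linarith)
  · have h1 := hw.one_le _ (Real.exp_pos y).le
    have h2 : y ≤ T := by linarith [Real.add_one_le_exp y]
    exact le_max_of_le_right (by nlinarith)

lemma IsAdmissibleWeight.youngConj_mono (hw : IsAdmissibleWeight w) {m m' : ℕ+} (h : m ≤ m')
    {s : ℝ} (hs : 0 ≤ s) :
    1 / (m : ℝ) * youngConj w (m * s) ≤ 1 / (m' : ℝ) * youngConj w (m' * s) := by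
  have hm : (0 : ℝ) < m := by exact_mod_cast m.pos
  have hm' : (0 : ℝ) < m' := by exact_mod_cast m'.pos
  have hmm : (m : ℝ) ≤ m' := by exact_mod_cast h
  have : Nonempty (Ioi (0 : ℝ)) := ⟨⟨1, mem_Ioi.2 one_pos⟩⟩
  rw [one_div_mul_eq_div, div_le_iff₀ hm]
  refine ciSup_le fun y => ?_
  have h1 := le_ciSup (hw.bddAbove (s := m' * s) (by positivity)) y
  have h2 := hw.one_le _ (Real.exp_pos (y : ℝ)).le
  change _ ≤ youngConj w _ at h1
  have h3 : (m : ℝ) / m' * (m' * s * y - w (Real.exp y)) ≤ m / m' * youngConj w (m' * s) := by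
    gcongr
  have h4 : (m : ℝ) / m' * (m' * s * y - w (Real.exp y))
      = m * s * y - m / m' * w (Real.exp y) := by
    field_simp
  have h5 : (m : ℝ) / m' * w (Real.exp y) ≤ 1 * w (Real.exp y) := by
    gcongr
    exact (div_le_one hm').2 hmm
  have h6 : 1 / (m' : ℝ) * youngConj w (m' * s) * m = m / m' * youngConj w (m' * s) := by ring
  rw [h6]
  linarith

lemma roumieuENorm_zero (K : Compacts (Rn n)) (m : ℕ+) :
    roumieuENorm w K m (0 : Rn n → ℂ) = 0 := by
  simp [roumieuENorm, multiDeriv]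

lemma multiDeriv_add {f g : Rn n → ℂ} (hf : ContDiff ℝ ∞ f) (hg : ContDiff ℝ ∞ g)
    (α : Fin n → ℕ) (x : Rn n) :
    multiDeriv α (f + g) x = multiDeriv α f x + multiDeriv α g x := by
  have h := iteratedFDeriv_add_apply (𝕜 := ℝ) (i := ∑ i, α i) (x := x)
    ((hf.of_le (by exact_mod_cast le_top)).contDiffAt)
    ((hg.of_le (by exact_mod_cast le_top)).contDiffAt)
  simp [multiDeriv, h]

lemma multiDeriv_smul {f : Rn n → ℂ} (hf : ContDiff ℝ ∞ f) (c : ℂ)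
    (α : Fin n → ℕ) (x : Rn n) :
    multiDeriv α (c • f) x = c * multiDeriv α f x := by
  have h := iteratedFDeriv_const_smul_apply (𝕜 := ℝ) (i := ∑ i, α i) (x := x) (a := c)
    ((hf.of_le (by exact_mod_cast le_top)).contDiffAt)
  simp [multiDeriv, h]

lemma roumieuENorm_add_le (K : Compacts (Rn n)) (m : ℕ+) {f g : Rn n → ℂ}
    (hf : ContDiff ℝ ∞ f) (hg : ContDiff ℝ ∞ g) :
    roumieuENorm w K m (f + g) ≤ roumieuENorm w K m f + roumieuENorm w K m g := by
  refine iSup₂_le fun x hx => iSup_le fun α => ?_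
  rw [multiDeriv_add hf hg]
  refine le_trans ?_ (add_le_add (le_iSup₂_of_le x hx (le_iSup_of_le α le_rfl))
    (le_iSup₂_of_le x hx (le_iSup_of_le α le_rfl)))
  rw [← ENNReal.ofReal_add (by positivity) (by positivity), ← add_div]
  gcongr
  exact norm_add_le _ _

lemma roumieuENorm_smul_le (K : Compacts (Rn n)) (m : ℕ+) (c : ℂ) {f : Rn n → ℂ}
    (hf : ContDiff ℝ ∞ f) :
    roumieuENorm w K m (c • f) ≤ ‖c‖ₑ * roumieuENorm w K m f := by
  refine iSup₂_le fun x hx => iSup_le fun α => ?_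
  rw [multiDeriv_smul hf, norm_mul, mul_div_assoc, ENNReal.ofReal_mul (norm_nonneg c),
    ofReal_norm]
  gcongr
  exact le_iSup₂_of_le x hx (le_iSup_of_le α le_rfl)

lemma roumieuENorm_anti (hw : IsAdmissibleWeight w) (K : Compacts (Rn n)) {m m' : ℕ+}
    (h : m ≤ m') (f : Rn n → ℂ) : roumieuENorm w K m' f ≤ roumieuENorm w K m f := by
  refine iSup₂_mono fun x _ => iSup_mono fun α => ?_
  exact ENNReal.ofReal_le_ofReal (div_le_div_of_nonneg_left (norm_nonneg _) (Real.exp_pos _)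
    (Real.exp_le_exp.2 (hw.youngConj_mono h (Nat.cast_nonneg _))))

/-- The smooth functions `f` with `roumieuENorm w K m f < ∞`, for a fixed compact set `K` and a
fixed `m`. -/
def roumieuStepSubmodule (n : ℕ) (w : AdmissibleWeight) (K : Compacts (Rn n)) (m : ℕ+) :
    Submodule ℂ (Rn n → ℂ) where
  carrier := {f | ContDiff ℝ ∞ f ∧ roumieuENorm w.1 K m f < ⊤}
  zero_mem' := ⟨contDiff_const, by simp [roumieuENorm_zero]⟩
  add_mem' {f g} hf hg := ⟨hf.1.add hg.1,
    (roumieuENorm_add_le K m hf.1 hg.1).trans_lt (ENNReal.add_lt_top.2 ⟨hf.2, hg.2⟩)⟩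
  smul_mem' c f hf := ⟨contDiff_const.smul hf.1,
    (roumieuENorm_smul_le K m c hf.1).trans_lt (ENNReal.mul_lt_top (by simp) hf.2)⟩

/-- The step `𝓔_w(K, m)`, a seminormed space. -/
def RoumieuStep (n : ℕ) (w : AdmissibleWeight) (K : Compacts (Rn n)) (m : ℕ+) : Type :=
  ↥(roumieuStepSubmodule n w K m)

/-- The smooth functions `f` such that `roumieuENorm w K m f < ∞` for some `m`, for a fixed
compact set `K`. -/
def roumieuLocalSubmodule (n : ℕ) (w : AdmissibleWeight) (K : Compacts (Rn n)) :
    Submodule ℂ (Rn n → ℂ) where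
  carrier := {f | ContDiff ℝ ∞ f ∧ ∃ m : ℕ+, roumieuENorm w.1 K m f < ⊤}
  zero_mem' := ⟨contDiff_const, 1, by simp [roumieuENorm_zero]⟩
  add_mem' := by
    rintro f g ⟨hf, a, ha⟩ ⟨hg, b, hb⟩
    refine ⟨hf.add hg, max a b, (roumieuENorm_add_le K _ hf hg).trans_lt ?_⟩
    exact ENNReal.add_lt_top.2
      ⟨(roumieuENorm_anti w.2 K (le_max_left a b) f).trans_lt ha,
        (roumieuENorm_anti w.2 K (le_max_right a b) g).trans_lt hb⟩
  smul_mem' := by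
    rintro c f ⟨hf, a, ha⟩
    exact ⟨contDiff_const.smul hf, a,
      (roumieuENorm_smul_le K a c hf).trans_lt (ENNReal.mul_lt_top (by simp) ha)⟩

/-- The union over `m` of the steps `𝓔_w(K, m)`. -/
def RoumieuLocal (n : ℕ) (w : AdmissibleWeight) (K : Compacts (Rn n)) : Type :=
  ↥(roumieuLocalSubmodule n w K)

/-- The Roumieu class `𝓔_{w}(ℝⁿ)`: the smooth functions `f : ℝⁿ → ℂ` such that for every compact
set `K` there is an `m` with `sup_{x ∈ K, α} |∂^α f(x)| / exp((1/m) φ*(m|α|)) < ∞`. -/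
def roumieuSubmodule (n : ℕ) (w : AdmissibleWeight) : Submodule ℂ (Rn n → ℂ) where
  carrier := {f | ContDiff ℝ ∞ f ∧
    ∀ K : Compacts (Rn n), ∃ m : ℕ+, roumieuENorm w.1 K m f < ⊤}
  zero_mem' := ⟨contDiff_const, fun K => ((roumieuLocalSubmodule n w K).zero_mem).2⟩
  add_mem' hf hg := ⟨hf.1.add hg.1, fun K =>
    ((roumieuLocalSubmodule n w K).add_mem ⟨hf.1, hf.2 K⟩ ⟨hg.1, hg.2 K⟩).2⟩
  smul_mem' c _ hf := ⟨contDiff_const.smul hf.1, fun K =>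
    ((roumieuLocalSubmodule n w K).smul_mem c ⟨hf.1, hf.2 K⟩).2⟩

/-- The space `𝓔_{w}(ℝⁿ)` of `w`-ultradifferentiable functions of Roumieu type. -/
def RoumieuSpace (n : ℕ) (w : AdmissibleWeight) : Type := ↥(roumieuSubmodule n w)

section Topology

variable {w : AdmissibleWeight} {K : Compacts (Rn n)} {m : ℕ+}

instance : AddCommGroup (RoumieuStep n w K m) :=
  inferInstanceAs (AddCommGroup ↥(roumieuStepSubmodule n w K m))

instance : Module ℂ (RoumieuStep n w K m) :=
  inferInstanceAs (Module ℂ ↥(roumieuStepSubmodule n w K m))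

/-- The seminorm `f ↦ sup_{x ∈ K, α} |∂^α f(x)| / exp((1/m) φ*(m|α|))` of `𝓔_w(K, m)`. -/
def RoumieuStep.normSeminorm (n : ℕ) (w : AdmissibleWeight) (K : Compacts (Rn n)) (m : ℕ+) :
    Seminorm ℂ (RoumieuStep n w K m) :=
  seminormOfENNReal (fun f => roumieuENorm w.1 K m f.1) (roumieuENorm_zero K m)
    (fun f g => roumieuENorm_add_le K m f.2.1 g.2.1)
    (fun c f => roumieuENorm_smul_le K m c f.2.1) (fun f => f.2.2.ne)

instance : SeminormedAddCommGroup (RoumieuStep n w K m) :=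
  (RoumieuStep.normSeminorm n w K m).toAddGroupSeminorm.toSeminormedAddCommGroup

instance : AddCommGroup (RoumieuLocal n w K) :=
  inferInstanceAs (AddCommGroup ↥(roumieuLocalSubmodule n w K))

instance : Module ℂ (RoumieuLocal n w K) :=
  inferInstanceAs (Module ℂ ↥(roumieuLocalSubmodule n w K))

instance : Module ℝ (RoumieuLocal n w K) :=
  inferInstanceAs (Module ℝ ↥(roumieuLocalSubmodule n w K))

/-- The inclusion of a step. -/
def RoumieuStep.toLocal (f : RoumieuStep n w K m) : RoumieuLocal n w K :=
  ⟨f.1, f.2.1, m, f.2.2⟩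

/-- The locally convex inductive limit topology over `m`: the finest locally convex vector space
topology for which the inclusions of all the steps `𝓔_w(K, m)` are continuous. -/
instance : TopologicalSpace (RoumieuLocal n w K) :=
  sInf {t : TopologicalSpace (RoumieuLocal n w K) |
    (∀ m : ℕ+, @Continuous (RoumieuStep n w K m) (RoumieuLocal n w K) _ t RoumieuStep.toLocal) ∧
    @IsTopologicalAddGroup (RoumieuLocal n w K) t _ ∧
    @ContinuousSMul ℂ (RoumieuLocal n w K) _ _ t ∧
    @LocallyConvexSpace ℝ (RoumieuLocal n w K) _ _ _ _ t}

instance : AddCommGroup (RoumieuSpace n w) :=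
  inferInstanceAs (AddCommGroup ↥(roumieuSubmodule n w))

instance : Module ℂ (RoumieuSpace n w) :=
  inferInstanceAs (Module ℂ ↥(roumieuSubmodule n w))

/-- The function underlying an element of `𝓔_{w}(ℝⁿ)`. -/
instance : CoeFun (RoumieuSpace n w) (fun _ => Rn n → ℂ) := ⟨fun f => f.1⟩

/-- The map `𝓔_{w}(ℝⁿ) → ⋃_m 𝓔_w(K, m)`. -/
def RoumieuSpace.toLocal (K : Compacts (Rn n)) (f : RoumieuSpace n w) : RoumieuLocal n w K :=
  ⟨f.1, f.2.1, f.2.2 K⟩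

/-- The topology of `𝓔_{w}(ℝⁿ)`: the projective limit over the compact sets `K` of the locally
convex inductive limits over `m` of the spaces `𝓔_w(K, m)`. -/
instance : TopologicalSpace (RoumieuSpace n w) :=
  ⨅ K : Compacts (Rn n), TopologicalSpace.induced (RoumieuSpace.toLocal K) inferInstance

end Topology

end UltraModulation

end

noncomputable section

namespace UltraModulation

/-! ### Growth of admissible weights -/

section Growth

variable {w : ℝ → ℝ}

/-! The spectrum of `□_k f` lies within distance `√n` of `k`, so `□_k f` is unchanged by a Fourier
multiplier that is a fixed cutoff translated to `k`. It therefore has a representative `G_k` with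
`G_k = Φ_k * G_k`, where `Φ_k` is a modulation of one Schwartz function. Hölder's inequality bounds
`G_k` by a multiple of `‖□_k f‖_p`, which is at most `e^{-w(|k|)} ‖f‖`; only the supremum part of
the `ℓ^q` norm is needed. Iterating `∇G_k = (∇Φ_k) * G_k` gives Bernstein's inequality: `j`
derivatives cost at most `(A (1 + |k|)) ^ j`.

The weight pays for this. By definition of `φ*`, `t ^ j ≤ e^{w(t)/m} e^{φ*(mj)/m}` for `t > 1`.
Regular variation gives `w(A(1+t)) ≤ L w(t) + B`, so for `m ≥ 2L` the power costs at most half of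
the decay `e^{-w}` (`exists_pow_mul_exp_neg_le`). The remaining `e^{-w(|k|)/2}` is summable over the
lattice because `w` beats every multiple of `log`.

Hence `F = ∑ G_k` is smooth, with bounds of Roumieu type that are global in `x` and have the same
`m` for all `f`; continuity follows. To see that `F = f`, test against `𝓕 ψ` with `ψ` compactly
supported: only finitely many symbols meet the support of `ψ`, and they sum to `1` there. Such test
functions are dense in `𝓢`. -/

lemma IsAdmissibleWeight.exists_le_mul_add (hw : IsAdmissibleWeight w) {C : ℝ} (hC : 1 ≤ C) :
    ∃ L B : ℝ, 0 < L ∧ 0 ≤ B ∧ ∀ t, 0 ≤ t → w (C * (1 + t)) ≤ L * w t + B := by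
  obtain ⟨α, -, -, hα⟩ := hw.regularlyVarying
  have hC0 : 0 < C := by linarith
  -- The dilation `2C` suffices because `C(1+t) ≤ 2Ct` once `t ≥ 1`. On the remaining bounded range
  -- of `t`, monotonicity of `w` supplies the constant `B`.
  have h1 : ∀ᶠ t in atTop, w (t * (2 * C)) / w t < (2 * C) ^ α + 1 :=
    (hα.tendsto (2 * C) (by positivity)).eventually_lt_const (by linarith)
  obtain ⟨T, hT⟩ := eventually_atTop.1 h1
  have hT' : 0 ≤ max T 1 := le_max_of_le_right zero_le_one
  have hL : 0 < (2 * C) ^ α + 1 := by positivity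
  refine ⟨(2 * C) ^ α + 1, w (C * (1 + max T 1)), hL,
    zero_le_one.trans (hw.one_le _ (by positivity)), fun t ht => ?_⟩
  have hwt := hw.one_le t ht
  have hwB := hw.one_le (C * (1 + max T 1)) (by positivity)
  rcases le_total t (max T 1) with h | h
  · have h2 : w (C * (1 + t)) ≤ w (C * (1 + max T 1)) :=
      hw.strictMonoOn.monotoneOn (mem_Ici.2 (by positivity)) (mem_Ici.2 (by positivity))
        (by gcongr)
    have : 0 ≤ ((2 * C) ^ α + 1) * w t := by positivity
    linarith
  · have h2 : w (C * (1 + t)) ≤ w (t * (2 * C)) := by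
      refine hw.strictMonoOn.monotoneOn (mem_Ici.2 (by positivity)) (mem_Ici.2 (by positivity)) ?_
      nlinarith [(le_max_right T 1).trans h]
    have h3 := (div_lt_iff₀ (by linarith)).1 (hT t ((le_max_left T 1).trans h))
    linarith

/-- The supremum defining `φ*(mj)` is tested at `y = log t`. The condition `1 < t` is what makes
this `y` positive. -/
lemma IsAdmissibleWeight.pow_le (hw : IsAdmissibleWeight w) (m : ℕ+) {t : ℝ} (ht : 1 < t)
    (j : ℕ) : t ^ j ≤ Real.exp (w t / m) * Real.exp (1 / (m : ℝ) * youngConj w (m * j)) := by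
  have hm : (0 : ℝ) < m := by exact_mod_cast m.pos
  have ht0 : 0 < t := by linarith
  have h1 := le_ciSup (hw.bddAbove (s := m * j) (by positivity))
    (⟨Real.log t, Real.log_pos ht⟩ : Ioi (0 : ℝ))
  change _ ≤ youngConj w _ at h1
  simp only [Real.exp_log ht0] at h1
  rw [← Real.exp_add, ← Real.exp_log (pow_pos ht0 j), Real.exp_le_exp, Real.log_pow]
  have h2 : (j : ℝ) * Real.log t = w t / m + 1 / m * (m * j * Real.log t - w t) := by
    field_simp
    ring
  rw [h2]
  gcongr

/-- Trades powers for the Young conjugate: `m ≥ 2L` gives `w(C(1+t))/m ≤ w(t)/2 + B`, so half of the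
decay survives for summation. Strictness of `1 < C` keeps `C(1+t) > 1` also at `t = 0`. -/
lemma IsAdmissibleWeight.exists_pow_mul_exp_neg_le (hw : IsAdmissibleWeight w) {C : ℝ}
    (hC : 1 < C) : ∃ (m : ℕ+) (D : ℝ), 0 ≤ D ∧ ∀ t, 0 ≤ t → ∀ j : ℕ,
      (C * (1 + t)) ^ j * Real.exp (-w t) ≤
        D * Real.exp (-(w t / 2)) * Real.exp (1 / (m : ℝ) * youngConj w (m * j)) := by
  obtain ⟨L, B, hL, hB, h⟩ := hw.exists_le_mul_add hC.le
  obtain ⟨m, hm⟩ := exists_nat_ge (2 * L)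
  have hm0 : 0 < m := by
    rcases Nat.eq_zero_or_pos m with rfl | h0
    · norm_num at hm
      linarith
    · exact h0
  refine ⟨⟨m, hm0⟩, Real.exp B, (Real.exp_pos _).le, fun t ht j => ?_⟩
  have ht1 : 1 < C * (1 + t) := by nlinarith
  refine (mul_le_mul_of_nonneg_right (hw.pow_le ⟨m, hm0⟩ ht1 j) (Real.exp_pos _).le).trans ?_
  rw [mul_right_comm]
  refine mul_le_mul_of_nonneg_right ?_ (Real.exp_pos _).le
  rw [← Real.exp_add, ← Real.exp_add, Real.exp_le_exp]
  have hm1 : (1 : ℝ) ≤ m := by exact_mod_cast hm0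
  have h1 : w (C * (1 + t)) / m ≤ w t / 2 + B := by
    rw [div_le_iff₀ (by linarith)]
    have := hw.one_le t ht
    nlinarith [h t ht]
  change w (C * (1 + t)) / m + _ ≤ _
  linarith

lemma IsAdmissibleWeight.exists_exp_neg_le (hw : IsAdmissibleWeight w) (N : ℕ) :
    ∃ D : ℝ, ∀ t, 0 < t → Real.exp (-(w t / 2)) ≤ D * (t ^ N)⁻¹ := by
  -- The multiple `2N` of the logarithm compensates for halving `w`.
  obtain ⟨T, hT⟩ := eventually_atTop.1
    ((hw.tendsto_sub_log (2 * N)).eventually_ge_atTop 0)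
  refine ⟨max 1 ((max T 0) ^ N), fun t ht => ?_⟩
  rw [← div_eq_mul_inv, le_div_iff₀ (by positivity)]
  rcases le_total T t with h | h
  · refine le_max_of_le_left ?_
    have := hT t h
    rw [← Real.exp_log (pow_pos ht N), ← Real.exp_add, Real.exp_le_one_iff, Real.log_pow]
    linarith
  · refine le_max_of_le_right ?_
    have h1 : Real.exp (-(w t / 2)) ≤ 1 := by
      rw [Real.exp_le_one_iff]
      linarith [hw.one_le t ht.le]
    calc _ ≤ 1 * t ^ N := by gcongr
      _ = t ^ N := one_mul _
      _ ≤ _ := by gcongr; exact h.trans (le_max_left _ _)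

lemma latticePoint_injective {n : ℕ} :
    Function.Injective (latticePoint : (Fin n → ℤ) → Rn n) := by
  intro k l h
  ext i
  simpa [latticePoint] using congrArg (fun x : Rn n => x i) h

lemma IsAdmissibleWeight.summable_exp_neg (hw : IsAdmissibleWeight w) (n : ℕ) :
    Summable fun k : Fin n → ℤ => Real.exp (-(w ‖latticePoint k‖ / 2)) := by
  let b := (EuclideanSpace.basisFun (Fin n) ℝ).toBasis
  let L : Submodule ℤ (Rn n) := Submodule.span ℤ (range b)
  have hmem (k : Fin n → ℤ) : latticePoint k ∈ L := by
    have h : latticePoint k = ∑ i, k i • b i := by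
      ext j
      simp [latticePoint, b, Finset.sum_apply, Pi.single_apply]
    rw [h]
    exact Submodule.sum_mem _ fun i _ => Submodule.smul_mem _ _ (Submodule.subset_span ⟨i, rfl⟩)
  have h1 := ZLattice.summable_norm_pow_inv (L := L) (Module.finrank ℤ L + 1) (by omega)
  have h2 := h1.comp_injective (i := fun k : Fin n → ℤ => (⟨latticePoint k, hmem k⟩ : L))
    fun k l h => latticePoint_injective (congrArg Subtype.val h)
  obtain ⟨D, hD⟩ := hw.exists_exp_neg_le (Module.finrank ℤ L + 1)
  -- Comparison with `|k|` to the power minus (rank + 1) fails at the origin, which is a single term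
  -- and may be dropped.
  refine (h2.mul_left D).of_norm_bounded_eventually ?_
  filter_upwards [(Set.finite_singleton (0 : Fin n → ℤ)).compl_mem_cofinite] with k hk
  rw [Real.norm_of_nonneg (Real.exp_pos _).le]
  have h0 : (latticePoint 0 : Rn n) = 0 := by
    ext i
    simp [latticePoint]
  have h3 := hD ‖latticePoint k‖ (norm_pos_iff.2 fun h : latticePoint k = 0 =>
    hk (latticePoint_injective (h.trans h0.symm)))
  rwa [← inv_pow] at h3

end Growth

/-! ### Functions reproduced by a Schwartz kernel -/

section Reproducing

variable {n : ℕ}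

/-- Provides the dominating function for differentiation under the integral. It is uniform over the
unit ball about `x₀` since `1 + |x₀ - y| ≤ 2(1 + |x - y|)` there; the exponent dimension + 1 makes
it integrable. -/
lemma exists_integrable_norm_sub_le {V : Type*} [NormedAddCommGroup V] [NormedSpace ℝ V]
    (K : 𝓢(Rn n, V)) : ∃ b : Rn n → ℝ, Integrable b ∧
      ∀ x₀ x y : Rn n, ‖x - x₀‖ ≤ 1 → ‖K (x - y)‖ ≤ b (x₀ - y) := by
  let N := Module.finrank ℝ (Rn n) + 1
  let S := 2 ^ N * (Finset.Iic (N, 0)).sup (schwartzSeminormFamily ℝ (Rn n) V) K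
  refine ⟨fun z => S * 2 ^ N * (1 + ‖z‖) ^ (-(N : ℝ)), ?_, fun x₀ x y hx => ?_⟩
  · exact (integrable_one_add_norm (by simp [N])).const_mul _
  · have h1 := SchwartzMap.one_add_le_sup_seminorm_apply (𝕜 := ℝ) (m := (N, 0)) (le_refl N)
      (le_refl 0) K (x - y)
    simp only [norm_iteratedFDeriv_zero] at h1
    have h2 : 1 + ‖x₀ - y‖ ≤ 2 * (1 + ‖x - y‖) := by
      have : ‖x₀ - y‖ ≤ ‖x - x₀‖ + ‖x - y‖ := by
        calc ‖x₀ - y‖ = ‖(x - y) - (x - x₀)‖ := by congr 1; abel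
          _ ≤ _ := by rw [add_comm]; exact norm_sub_le _ _
      linarith [norm_nonneg (x - y)]
    have h3 : (1 + ‖x₀ - y‖) ^ N ≤ 2 ^ N * (1 + ‖x - y‖) ^ N := by
      rw [← mul_pow]
      gcongr
    have h4 : 0 < (1 + ‖x₀ - y‖) ^ N := by positivity
    beta_reduce
    rw [Real.rpow_neg (by positivity), Real.rpow_natCast, ← div_eq_mul_inv, le_div_iff₀ h4]
    calc _ ≤ ‖K (x - y)‖ * (2 ^ N * (1 + ‖x - y‖) ^ N) := by gcongr
      _ = 2 ^ N * ((1 + ‖x - y‖) ^ N * ‖K (x - y)‖) := by ring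
      _ ≤ 2 ^ N * S := mul_le_mul_of_nonneg_left h1 (by positivity)
      _ = _ := by ring

variable {F : Type*} [NormedAddCommGroup F] [NormedSpace ℝ F] [NormedSpace ℂ F]
  [IsScalarTower ℝ ℂ F]

lemma norm_smulRight_le (c : Rn n →L[ℝ] ℂ) (g : F) : ‖c.smulRight g‖ ≤ ‖c‖ * ‖g‖ := by
  refine ContinuousLinearMap.opNorm_le_bound _ (by positivity) fun v => ?_
  rw [ContinuousLinearMap.smulRight_apply, norm_smul, mul_right_comm]
  gcongr
  exact c.le_opNorm v

/-- If `G` is bounded and `G = Φ * G`, then `G` is differentiable, and the derivative of `G` is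
`(∇Φ) * G`. -/
lemma hasFDerivAt_of_reproducing (Φ : 𝓢(Rn n, ℂ)) {G : Rn n → F} {B : ℝ}
    (hG : AEStronglyMeasurable G) (hB : ∀ x, ‖G x‖ ≤ B)
    (hrep : ∀ x, G x = ∫ y, Φ (x - y) • G y) (x₀ : Rn n) :
    HasFDerivAt G (∫ y, (fderiv ℝ Φ (x₀ - y)).smulRight (G y)) x₀ := by
  have hB0 : 0 ≤ B := (norm_nonneg _).trans (hB 0)
  obtain ⟨b, hb, hbK⟩ := exists_integrable_norm_sub_le (SchwartzMap.fderivCLM ℝ (Rn n) ℂ Φ)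
  have key : HasFDerivAt (fun x => ∫ y, Φ (x - y) • G y)
      (∫ y, (fderiv ℝ Φ (x₀ - y)).smulRight (G y)) x₀ := by
    refine hasFDerivAt_integral_of_dominated_of_fderiv_le
      (F := fun x y => Φ (x - y) • G y)
      (F' := fun x y => (fderiv ℝ Φ (x - y)).smulRight (G y))
      (bound := fun y => b (x₀ - y) * B)
      (Metric.closedBall_mem_nhds x₀ one_pos) ?_ ?_ ?_ ?_ ?_ ?_
    · refine Eventually.of_forall fun x => ?_
      exact (Φ.continuous.comp (continuous_const.sub continuous_id)).aestronglyMeasurable.smul hG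
    · refine Integrable.smul_bdd (Φ.integrable.comp_sub_left x₀) B hG
        (Eventually.of_forall hB)
    · have h1 : Continuous fun y => fderiv ℝ Φ (x₀ - y) :=
        (SchwartzMap.fderivCLM ℝ (Rn n) ℂ Φ).continuous.comp (continuous_const.sub continuous_id)
      have h2 : Continuous fun q : (Rn n →L[ℝ] ℂ) × F =>
          ((ContinuousLinearMap.lsmul ℝ ℂ : ℂ →L[ℝ] F →L[ℝ] F).flip q.2).comp q.1 := by fun_prop
      exact h2.comp_aestronglyMeasurable (h1.aestronglyMeasurable.prodMk hG)
    · refine Eventually.of_forall fun y x hx => ?_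
      have h1 := hbK x₀ x y (by simpa [dist_eq_norm] using hx)
      exact (norm_smulRight_le _ _).trans
        (mul_le_mul h1 (hB y) (norm_nonneg _) ((norm_nonneg _).trans h1))
    · exact (hb.comp_sub_left x₀).mul_const B
    · refine Eventually.of_forall fun y x hx => ?_
      have h1 : HasFDerivAt (fun x => Φ (x - y)) (fderiv ℝ Φ (x - y)) x := by
        exact (hasFDerivAt_comp_sub y).2 (Φ.hasFDerivAt (x - y))
      exact h1.smul_const (G y)
  have : (fun x => ∫ y, Φ (x - y) • G y) = G := funext fun x => (hrep x).symm
  rwa [this] at key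

lemma norm_fderiv_le_of_reproducing (Φ : 𝓢(Rn n, ℂ)) {G : Rn n → F} {B : ℝ}
    (hG : AEStronglyMeasurable G) (hB : ∀ x, ‖G x‖ ≤ B)
    (hrep : ∀ x, G x = ∫ y, Φ (x - y) • G y) (x : Rn n) :
    ‖fderiv ℝ G x‖ ≤ (∫ y, ‖fderiv ℝ Φ y‖) * B := by
  have hΦ : Integrable fun y => fderiv ℝ Φ y :=
    (SchwartzMap.fderivCLM ℝ (Rn n) ℂ Φ).integrable
  rw [(hasFDerivAt_of_reproducing Φ hG hB hrep x).fderiv,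
    ← integral_sub_left_eq_self (fun y => ‖fderiv ℝ Φ y‖) volume x, ← integral_mul_const]
  refine norm_integral_le_of_norm_le ((hΦ.comp_sub_left x).norm.mul_const B)
    (Eventually.of_forall fun y => (norm_smulRight_le _ _).trans ?_)
  gcongr
  exact hB y

/-- Here the derivative falls on `G` instead of on the kernel: in `∫ Φ(y) G(x - y) dy` the gradient
of `G` is already known to be bounded, which gives domination. Since the gradient is reproduced by
the same kernel, the first-order bound can be iterated. -/
lemma fderiv_reproducing (Φ : 𝓢(Rn n, ℂ)) {G : Rn n → F} {B : ℝ}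
    (hG : AEStronglyMeasurable G) (hB : ∀ x, ‖G x‖ ≤ B)
    (hrep : ∀ x, G x = ∫ y, Φ (x - y) • G y)
    (hG' : AEStronglyMeasurable (fderiv ℝ G)) (x₀ : Rn n) :
    fderiv ℝ G x₀ = ∫ y, Φ (x₀ - y) • fderiv ℝ G y := by
  have hd (x : Rn n) : HasFDerivAt G (fderiv ℝ G x) x :=
    (hasFDerivAt_of_reproducing Φ hG hB hrep x).differentiableAt.hasFDerivAt
  have hc : Continuous G := continuous_iff_continuousAt.2 fun x => (hd x).continuousAt
  have hB' := norm_fderiv_le_of_reproducing Φ hG hB hrep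
  have key : HasFDerivAt (fun x => ∫ y, Φ y • G (x - y))
      (∫ y, Φ y • fderiv ℝ G (x₀ - y)) x₀ := by
    refine hasFDerivAt_integral_of_dominated_of_fderiv_le
      (F := fun x y => Φ y • G (x - y)) (F' := fun x y => Φ y • fderiv ℝ G (x - y))
      (bound := fun y => ‖Φ y‖ * ((∫ y, ‖fderiv ℝ Φ y‖) * B)) univ_mem ?_ ?_ ?_ ?_ ?_ ?_
    · exact Eventually.of_forall fun x => (Φ.continuous.smul
        (hc.comp (continuous_const.sub continuous_id))).aestronglyMeasurable
    · exact Integrable.smul_bdd Φ.integrable B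
        (hc.comp (continuous_const.sub continuous_id)).aestronglyMeasurable
        (Eventually.of_forall fun y => hB _)
    · exact Φ.continuous.aestronglyMeasurable.smul
        (hG'.comp_measurePreserving (Measure.measurePreserving_sub_left volume x₀))
    · refine Eventually.of_forall fun y x _ => ?_
      rw [norm_smul]
      gcongr
      exact hB' _
    · exact Φ.integrable.norm.mul_const _
    · exact Eventually.of_forall fun y x _ =>
        ((hasFDerivAt_comp_sub y).2 (hd (x - y))).const_smul (Φ y)
  have h1 : (fun x => ∫ y, Φ y • G (x - y)) = G := by
    funext x
    rw [hrep x, ← integral_sub_left_eq_self _ volume x]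
    simp
  rw [h1] at key
  rw [key.fderiv, ← integral_sub_left_eq_self _ volume x₀]
  simp

/-- **Bernstein's inequality** for bounded functions that are reproduced by a Schwartz kernel. -/
theorem contDiff_and_norm_iteratedFDeriv_le_of_reproducing (Φ : 𝓢(Rn n, ℂ)) (j : ℕ) :
    ∀ {F : Type} [NormedAddCommGroup F] [NormedSpace ℝ F] [NormedSpace ℂ F]
      [IsScalarTower ℝ ℂ F] [FiniteDimensional ℝ F] {G : Rn n → F} {B : ℝ},
      AEStronglyMeasurable G → (∀ x, ‖G x‖ ≤ B) → (∀ x, G x = ∫ y, Φ (x - y) • G y) →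
      ContDiff ℝ j G ∧
        ∀ x, ‖iteratedFDeriv ℝ j G x‖ ≤ (∫ y, ‖fderiv ℝ Φ y‖) ^ j * B := by
  -- The target space `F` varies in the induction, because the hypothesis is applied to `fderiv ℝ
  -- G`, with values in `Rn n →L[ℝ] F`. Finite dimension makes this space second countable, hence
  -- the gradient strongly measurable.
  induction j with
  | zero =>
    intro F _ _ _ _ _ G B hG hB hrep
    refine ⟨contDiff_zero.2 (continuous_iff_continuousAt.2 fun x =>
      (hasFDerivAt_of_reproducing Φ hG hB hrep x).continuousAt), fun x => ?_⟩
    simpa using hB x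
  | succ j ih =>
    intro F _ _ _ _ _ G B hG hB hrep
    have : FiniteDimensional ℝ (Rn n →L[ℝ] F) := inferInstance
    have : SecondCountableTopology (Rn n →L[ℝ] F) := inferInstance
    have hG' : AEStronglyMeasurable (fderiv ℝ G) := by
      borelize (Rn n →L[ℝ] F)
      exact (measurable_fderiv ℝ G).aestronglyMeasurable
    obtain ⟨h1, h2⟩ := ih hG' (norm_fderiv_le_of_reproducing Φ hG hB hrep)
      (fderiv_reproducing Φ hG hB hrep hG')
    refine ⟨?_, fun x => ?_⟩
    · rw [Nat.cast_succ, contDiff_succ_iff_fderiv]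
      exact ⟨fun x => (hasFDerivAt_of_reproducing Φ hG hB hrep x).differentiableAt, by simp, h1⟩
    · rw [← norm_iteratedFDeriv_fderiv, pow_succ, mul_assoc]
      exact h2 x

end Reproducing

/-! ### Density of the compactly supported functions in the Schwartz space -/

section Density

variable {n : ℕ}

lemma norm_iteratedFDeriv_one_sub_le (χ : 𝓢(Rn n, ℝ)) (i : ℕ) (x : Rn n) :
    ‖iteratedFDeriv ℝ i (fun x => 1 - χ x) x‖ ≤ 1 + SchwartzMap.seminorm ℝ 0 i χ := by
  have h := iteratedFDeriv_sub_apply (𝕜 := ℝ) (i := i) (x := x)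
    (contDiff_const (c := (1 : ℝ))).contDiffAt (χ.smooth i).contDiffAt
  change ‖iteratedFDeriv ℝ i ((fun _ => (1 : ℝ)) - ⇑χ) x‖ ≤ _
  rw [h]
  refine (norm_sub_le _ _).trans (add_le_add ?_ (χ.norm_iteratedFDeriv_le_seminorm ℝ i x))
  rcases Nat.eq_zero_or_pos i with rfl | hi
  · simp
  · rw [iteratedFDeriv_const_of_ne hi.ne']
    simp

/-- The chain rule contributes at most `c ^ i ≤ 1`, so the bound is uniform in the dilation. -/
lemma norm_iteratedFDeriv_one_sub_comp_smul_le (χ : 𝓢(Rn n, ℝ)) {c : ℝ} (hc0 : 0 ≤ c)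
    (hc : c ≤ 1) (i : ℕ) (x : Rn n) :
    ‖iteratedFDeriv ℝ i (fun x => 1 - χ (c • x)) x‖ ≤ 1 + SchwartzMap.seminorm ℝ 0 i χ := by
  have hθ : ContDiff ℝ i (fun x => 1 - χ x) := contDiff_const.sub (χ.smooth i)
  have h := (c • ContinuousLinearMap.id ℝ (Rn n)).iteratedFDeriv_comp_right hθ x le_rfl
  change ‖iteratedFDeriv ℝ i ((fun x => 1 - χ x) ∘ (c • ContinuousLinearMap.id ℝ (Rn n))) x‖ ≤ _
  rw [h]
  refine (ContinuousMultilinearMap.norm_compContinuousLinearMap_le _ _).trans ?_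
  have h1 : ‖c • ContinuousLinearMap.id ℝ (Rn n)‖ ≤ 1 := by
    rw [norm_smul, Real.norm_of_nonneg hc0]
    exact mul_le_one₀ hc (norm_nonneg _) ContinuousLinearMap.norm_id_le
  have h2 : ∏ _ : Fin i, ‖c • ContinuousLinearMap.id ℝ (Rn n)‖ ≤ 1 :=
    Finset.prod_le_one (fun _ _ => norm_nonneg _) fun _ _ => h1
  calc _ ≤ (1 + SchwartzMap.seminorm ℝ 0 i χ) * 1 :=
        mul_le_mul (norm_iteratedFDeriv_one_sub_le χ i _) h2 (by positivity) (by positivity)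
    _ = _ := mul_one _

/-- The approximants are `χ(cx) ψ(x)` with `c = 1/(N+1)`. The error vanishes where `c|x| < 1`;
elsewhere `1 ≤ c|x|`, so one extra power of `|x|`, absorbed by the seminorm of order `k + 1`, buys a
factor `c`. -/
lemma exists_tendsto_hasCompactSupport (ψ : 𝓢(Rn n, ℂ)) :
    ∃ s : ℕ → 𝓢(Rn n, ℂ), (∀ N, HasCompactSupport (s N)) ∧ Tendsto s atTop (𝓝 ψ) := by
  let β : ContDiffBump (0 : Rn n) := ⟨1, 2, one_pos, one_lt_two⟩
  let χ : 𝓢(Rn n, ℝ) := β.hasCompactSupport.toSchwartzMap β.contDiff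
  have hχ (x : Rn n) : χ x = β x := rfl
  let c : ℕ → ℝ := fun N => 1 / ((N : ℝ) + 1)
  have hc0 (N : ℕ) : 0 < c N := Nat.one_div_pos_of_nat
  have hc1 (N : ℕ) : c N ≤ 1 := by
    rw [div_le_one (by positivity)]
    linarith [Nat.cast_nonneg (α := ℝ) N]
  have hsupp (N : ℕ) : HasCompactSupport fun x => χ (c N • x) • ψ x :=
    (β.hasCompactSupport.comp_smul (hc0 N).ne').smul_right
  have hsmooth (N : ℕ) : ContDiff ℝ ∞ fun x => χ (c N • x) • ψ x :=
    ((χ.smooth ⊤).comp (contDiff_const_smul (c N))).smul (ψ.smooth ⊤)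
  refine ⟨fun N => (hsupp N).toSchwartzMap (hsmooth N), hsupp, ?_⟩
  rw [(schwartz_withSeminorms ℝ (Rn n) ℂ).tendsto_nhds]
  rintro ⟨k, m⟩ ε hε
  let M : ℝ := ∑ i ∈ Finset.range (m + 1), (m.choose i : ℝ) *
    (1 + SchwartzMap.seminorm ℝ 0 i χ) * SchwartzMap.seminorm ℝ (k + 1) (m - i) ψ
  have hM : 0 ≤ M := Finset.sum_nonneg fun i _ => by positivity
  have key (N : ℕ) : SchwartzMap.seminorm ℝ k m
      ((hsupp N).toSchwartzMap (hsmooth N) - ψ) ≤ c N * M := by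
    rw [← map_neg_eq_map, neg_sub]
    refine SchwartzMap.seminorm_le_bound ℝ k m _ (by have := hc0 N; positivity) fun x => ?_
    have hfun : ⇑(ψ - (hsupp N).toSchwartzMap (hsmooth N)) =
        fun x => (1 - χ (c N • x)) • ψ x := by
      funext x
      simp [sub_smul]
    rw [hfun]
    rcases lt_or_ge ‖c N • x‖ 1 with hx | hx
    · have h0 : (fun x => (1 - χ (c N • x)) • ψ x) =ᶠ[𝓝 x] fun _ => 0 := by
        have hopen : IsOpen {x : Rn n | ‖c N • x‖ < 1} :=
          isOpen_lt (by fun_prop) continuous_const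
        filter_upwards [hopen.mem_nhds hx] with y hy
        have : β (c N • y) = 1 := β.one_of_mem_closedBall (by simpa using le_of_lt hy)
        rw [hχ, this, sub_self, zero_smul]
      rw [(h0.iteratedFDeriv ℝ m).eq_of_nhds]
      have h00 : iteratedFDeriv ℝ m (fun _ : Rn n => (0 : ℂ)) x = 0 := by
        rw [iteratedFDeriv_fun_zero]
        rfl
      rw [h00, norm_zero, mul_zero]
      have := hc0 N
      positivity
    · have h1 : 1 ≤ c N * ‖x‖ := by
        rwa [norm_smul, Real.norm_of_nonneg (hc0 N).le] at hx
      have h2 := norm_iteratedFDeriv_smul_le (𝕜 := ℝ) (𝕜' := ℝ) (N := ∞) (n := m)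
        (f := fun x => 1 - χ (c N • x)) (g := ψ)
        (contDiff_const.sub ((χ.smooth ⊤).comp (contDiff_const_smul (c N)))) (ψ.smooth ⊤) x
        (by exact_mod_cast le_top)
      calc _ ≤ ‖x‖ ^ k * ∑ i ∈ Finset.range (m + 1), (m.choose i : ℝ) *
            (1 + SchwartzMap.seminorm ℝ 0 i χ) * ‖iteratedFDeriv ℝ (m - i) ψ x‖ := by
            gcongr
            refine h2.trans (Finset.sum_le_sum fun i _ => ?_)
            gcongr
            exact norm_iteratedFDeriv_one_sub_comp_smul_le χ (hc0 N).le (hc1 N) i x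
        _ ≤ (c N * ‖x‖) * (‖x‖ ^ k * ∑ i ∈ Finset.range (m + 1), (m.choose i : ℝ) *
            (1 + SchwartzMap.seminorm ℝ 0 i χ) * ‖iteratedFDeriv ℝ (m - i) ψ x‖) :=
            le_mul_of_one_le_left (mul_nonneg (by positivity)
              (Finset.sum_nonneg fun i _ => by positivity)) h1
        _ = c N * ∑ i ∈ Finset.range (m + 1), (m.choose i : ℝ) *
            (1 + SchwartzMap.seminorm ℝ 0 i χ) *
              (‖x‖ ^ (k + 1) * ‖iteratedFDeriv ℝ (m - i) ψ x‖) := by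
            simp only [Finset.mul_sum]
            refine Finset.sum_congr rfl fun i _ => ?_
            ring
        _ ≤ c N * M := by
            have := (hc0 N).le
            refine mul_le_mul_of_nonneg_left (Finset.sum_le_sum fun i _ => ?_) this
            exact mul_le_mul_of_nonneg_left (ψ.le_seminorm ℝ (k + 1) _ x) (by positivity)
  have hlim : Tendsto (fun N => c N * M) atTop (𝓝 0) := by
    simpa only [zero_mul] using
      (tendsto_one_div_add_atTop_nhds_zero_nat (𝕜 := ℝ)).mul_const M
  filter_upwards [hlim.eventually_lt_const hε] with N hN
  exact (key N).trans_lt hN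

end Density

section Fourier

open FourierTransform
open scoped RealInnerProductSpace

variable {n : ℕ}

/-! ### Translation and the Fourier transform -/

lemma fourier_compSubConstCLM (u : 𝓢(Rn n, ℂ)) (a ξ : Rn n) :
    𝓕 (SchwartzMap.compSubConstCLM ℂ a u) ξ = Real.fourierChar (-⟪a, ξ⟫) • 𝓕 u ξ := by
  rw [SchwartzMap.fourier_coe, SchwartzMap.fourier_coe, Real.fourier_eq, Real.fourier_eq,
    ← integral_add_right_eq_self _ a, Circle.smul_def, ← integral_smul]
  refine integral_congr_ae (Eventually.of_forall fun v => ?_)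
  simp only [SchwartzMap.compSubConstCLM_apply, add_sub_cancel_right, inner_add_left, neg_add,
    AddChar.map_add_eq_mul, Circle.smul_def, Circle.coe_mul, smul_eq_mul]
  ring

lemma fourierInv_compSubConstCLM (u : 𝓢(Rn n, ℂ)) (a x : Rn n) :
    𝓕⁻ (SchwartzMap.compSubConstCLM ℂ a u) x = Real.fourierChar ⟪a, x⟫ • 𝓕⁻ u x := by
  rw [SchwartzMap.fourierInv_coe, SchwartzMap.fourierInv_coe, Real.fourierInv_eq,
    Real.fourierInv_eq, ← integral_add_right_eq_self _ a, Circle.smul_def, ← integral_smul]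
  refine integral_congr_ae (Eventually.of_forall fun v => ?_)
  simp only [SchwartzMap.compSubConstCLM_apply, add_sub_cancel_right, inner_add_left,
    AddChar.map_add_eq_mul, Circle.smul_def, Circle.coe_mul, smul_eq_mul]
  ring

lemma norm_fourierInv_compSubConstCLM (u : 𝓢(Rn n, ℂ)) (a x : Rn n) :
    ‖𝓕⁻ (SchwartzMap.compSubConstCLM ℂ a u) x‖ = ‖𝓕⁻ u x‖ := by
  rw [fourierInv_compSubConstCLM, Circle.norm_smul]

/-- A translation in frequency is a modulation in space. Differentiating the character by the
product rule produces the term linear in `‖a‖`, the source of the factor `1 + |k|` in Bernstein's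
inequality. -/
lemma norm_fderiv_fourierInv_compSubConstCLM_le (u : 𝓢(Rn n, ℂ)) (a x : Rn n) :
    ‖fderiv ℝ (𝓕⁻ (SchwartzMap.compSubConstCLM ℂ a u) : 𝓢(Rn n, ℂ)) x‖ ≤
      2 * Real.pi * ‖a‖ * ‖𝓕⁻ u x‖ + ‖fderiv ℝ (𝓕⁻ u : 𝓢(Rn n, ℂ)) x‖ := by
  have h1 : HasFDerivAt (fun x : Rn n => (Real.fourierChar ⟪a, x⟫ : ℂ))
      ((innerSL ℝ a).smulRight
        (2 * Real.pi * Complex.I * (Real.fourierChar ⟪a, x⟫ : ℂ))) x := by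
    have := (Real.hasDerivAt_fourierChar ⟪a, x⟫).hasFDerivAt.comp x (innerSL ℝ a).hasFDerivAt
    have h : ((innerSL ℝ a).smulRight
        (2 * Real.pi * Complex.I * (Real.fourierChar ⟪a, x⟫ : ℂ)) : Rn n →L[ℝ] ℂ) =
        (ContinuousLinearMap.toSpanSingleton ℝ
          (2 * Real.pi * Complex.I * (Real.fourierChar ⟪a, x⟫ : ℂ))).comp (innerSL ℝ a) := by
      ext v
      simp
    rw [h]
    exact this
  have h2 := h1.mul ((𝓕⁻ u : 𝓢(Rn n, ℂ)).hasFDerivAt x)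
  have h3 : (fun x : Rn n => (Real.fourierChar ⟪a, x⟫ : ℂ)) * ⇑(𝓕⁻ u : 𝓢(Rn n, ℂ)) =
      ⇑(𝓕⁻ (SchwartzMap.compSubConstCLM ℂ a u) : 𝓢(Rn n, ℂ)) := by
    funext x
    rw [fourierInv_compSubConstCLM]
    rfl
  rw [h3] at h2
  rw [h2.fderiv, add_comm]
  refine (norm_add_le _ _).trans (add_le_add ?_ ?_)
  · rw [norm_smul, mul_comm]
    gcongr
    rw [ContinuousLinearMap.norm_smulRight_apply, innerSL_apply_norm]
    simp [abs_of_pos Real.pi_pos, mul_comm, Circle.norm_coe]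
  · rw [norm_smul, Circle.norm_coe, one_mul]

lemma integral_norm_fderiv_fourierInv_compSubConstCLM_le (u : 𝓢(Rn n, ℂ)) (a : Rn n) :
    ∫ x, ‖fderiv ℝ (𝓕⁻ (SchwartzMap.compSubConstCLM ℂ a u) : 𝓢(Rn n, ℂ)) x‖ ≤
      2 * Real.pi * ‖a‖ * (∫ x, ‖𝓕⁻ u x‖) + ∫ x, ‖fderiv ℝ (𝓕⁻ u : 𝓢(Rn n, ℂ)) x‖ := by
  have h1 (v : 𝓢(Rn n, ℂ)) : Integrable fun x => ‖fderiv ℝ v x‖ :=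
    (SchwartzMap.fderivCLM ℝ (Rn n) ℂ v).integrable.norm
  rw [← integral_const_mul, ← integral_add ((𝓕⁻ u : 𝓢(Rn n, ℂ)).integrable.norm.const_mul _) (h1 _)]
  exact integral_mono (h1 _) (((𝓕⁻ u : 𝓢(Rn n, ℂ)).integrable.norm.const_mul _).add (h1 _))
    (norm_fderiv_fourierInv_compSubConstCLM_le u a)

/-- The pairing identity for `𝓕⁻` is applied to `φ` and the Fourier transform of the kernel
translated by `y`; this translation becomes the character in the Fourier integral at `y`. -/
lemma fourier_smulLeftCLM_fourierInv (χ φ : 𝓢(Rn n, ℂ)) (y : Rn n) :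
    𝓕 (SchwartzMap.smulLeftCLM ℂ χ (𝓕⁻ φ)) y = ∫ x, φ x * 𝓕⁻ χ (x - y) := by
  have h := SchwartzMap.integral_fourierInv_mul_eq φ
    (𝓕 (SchwartzMap.compSubConstCLM ℂ y (𝓕⁻ χ)))
  simp only [fourierInv_fourier_eq, fourier_compSubConstCLM, fourier_fourierInv_eq,
    SchwartzMap.compSubConstCLM_apply] at h
  rw [← h, SchwartzMap.fourier_coe, Real.fourier_eq]
  refine integral_congr_ae (Eventually.of_forall fun ξ => ?_)
  simp only [SchwartzMap.smulLeftCLM_apply_apply χ.hasTemperateGrowth, smul_eq_mul,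
    Circle.smul_def, real_inner_comm]
  ring

/-! ### Functions with a compact Fourier spectrum -/

lemma ae_eq_of_forall_integral_schwartz {f g : Rn n → ℂ} (hf : LocallyIntegrable f)
    (hg : LocallyIntegrable g) (h : ∀ φ : 𝓢(Rn n, ℂ), ∫ x, φ x • f x = ∫ x, φ x • g x) :
    f =ᵐ[volume] g := by
  refine ae_eq_of_integral_contDiff_smul_eq hf hg fun φ hφ hc => ?_
  have hc' : HasCompactSupport (Complex.ofRealCLM ∘ φ) := hc.comp_left rfl
  have hφ' : ContDiff ℝ ∞ (Complex.ofRealCLM ∘ φ) := by fun_prop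
  simpa using h (hc'.toSchwartzMap hφ')

variable {p q : ENNReal} [ENNReal.HolderConjugate q p]

/-- Hölder's inequality, where `q` is the exponent conjugate to `p`. The map `y ↦ x - y` preserves
the measure, so the constant does not depend on `x`. -/
lemma integrable_and_integral_norm_smul_le (Φ : 𝓢(Rn n, ℂ))
    (g : Lp ℂ p (volume : Measure (Rn n))) (x : Rn n) :
    Integrable (fun y => Φ (x - y) • g y) ∧
      ∫ y, ‖Φ (x - y) • g y‖ ≤ (eLpNorm Φ q volume).toReal * ‖g‖ := by
  have hm := Measure.measurePreserving_sub_left (volume : Measure (Rn n)) x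
  have hΦ : MemLp (fun y => Φ (x - y)) q volume :=
    (Φ.memLp q volume).comp_measurePreserving hm
  have h1 : MemLp (fun y => Φ (x - y) • g y) 1 volume := (Lp.memLp g).smul hΦ
  refine ⟨memLp_one_iff_integrable.1 h1, ?_⟩
  have h2 : eLpNorm (fun y => Φ (x - y) • g y) 1 volume ≤
      eLpNorm (fun y => Φ (x - y)) q volume * eLpNorm g p volume := by
    have h := eLpNorm_smul_le_mul_eLpNorm (p := q) (q := p) (r := 1)
      (Lp.aestronglyMeasurable g) hΦ.1
    exact h
  have h3 : eLpNorm (fun y => Φ (x - y)) q volume =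
      eLpNorm Φ q volume :=
    eLpNorm_comp_measurePreserving Φ.continuous.aestronglyMeasurable hm
  rw [integral_norm_eq_lintegral_enorm h1.1, ← eLpNorm_one_eq_lintegral_enorm, Lp.norm_def,
    ← ENNReal.toReal_mul, ← h3]
  exact ENNReal.toReal_mono (ENNReal.mul_ne_top hΦ.2.ne (Lp.eLpNorm_ne_top g)) h2

/-- If the distribution defined by `g ∈ L^p` is fixed by the Fourier multiplier `χ ∈ 𝓢`, then `g`
agrees almost everywhere with a bounded function that is reproduced by the kernel `𝓕⁻ χ`. -/
lemma exists_reproducing_of_fourierMultiplier_eq [Fact (1 ≤ p)] (χ : 𝓢(Rn n, ℂ))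
    (g : Lp ℂ p (volume : Measure (Rn n)))
    (h : TemperedDistribution.fourierMultiplierCLM ℂ χ
      (Lp.toTemperedDistributionCLM ℂ volume p g) = Lp.toTemperedDistributionCLM ℂ volume p g) :
    ∃ G : Rn n → ℂ, AEStronglyMeasurable G ∧ g =ᵐ[volume] G ∧
      (∀ x, ‖G x‖ ≤ (eLpNorm (𝓕⁻ χ : 𝓢(Rn n, ℂ)) q volume).toReal * ‖g‖) ∧
      ∀ x, G x = ∫ y, 𝓕⁻ χ (x - y) • G y := by
  let Φ : 𝓢(Rn n, ℂ) := 𝓕⁻ χ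
  have hg : AEStronglyMeasurable g := Lp.aestronglyMeasurable g
  have hmeas : AEStronglyMeasurable (fun z : Rn n × Rn n => Φ (z.1 - z.2) • g z.2)
      (volume.prod volume) :=
    (Φ.continuous.comp (continuous_fst.sub continuous_snd)).aestronglyMeasurable.smul hg.comp_snd
  have hG : AEStronglyMeasurable (fun x => ∫ y, Φ (x - y) • g y) := hmeas.integral_prod_right'
  have hB (x : Rn n) : ‖∫ y, Φ (x - y) • g y‖ ≤
      (eLpNorm Φ q volume).toReal * ‖g‖ :=
    (norm_integral_le_integral_norm _).trans (integrable_and_integral_norm_smul_le (q := q) Φ g x).2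
  have hae : g =ᵐ[volume] fun x => ∫ y, Φ (x - y) • g y := by
    refine ae_eq_of_forall_integral_schwartz ((Lp.memLp g).locallyIntegrable Fact.out)
      ((memLp_top_of_bound hG _ (Eventually.of_forall hB)).locallyIntegrable le_top) fun φ => ?_
    -- Testing the multiplier identity against `φ` puts the kernel on the test function; Fubini then
    -- moves it back onto `g`.
    have h1 := congrArg (fun u : 𝓢'(Rn n, ℂ) => u φ) h
    simp only [TemperedDistribution.fourierMultiplierCLM_apply_apply,
      Lp.toTemperedDistributionCLM_apply, Lp.toTemperedDistribution_apply,
      fourier_smulLeftCLM_fourierInv] at h1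
    have hint : Integrable (Function.uncurry fun x y => φ x • (Φ (x - y) • g y))
        (volume.prod volume) := by
      have hmeas' : AEStronglyMeasurable (Function.uncurry fun x y => φ x • (Φ (x - y) • g y))
          (volume.prod volume) :=
        (φ.continuous.comp continuous_fst).aestronglyMeasurable.smul hmeas
      refine (integrable_prod_iff hmeas').2 ⟨Eventually.of_forall fun x =>
        (integrable_and_integral_norm_smul_le (q := q) Φ g x).1.smul (φ x), ?_⟩
      refine (φ.integrable.norm.mul_const
        ((eLpNorm Φ q volume).toReal * ‖g‖)).mono'
        hmeas'.norm.integral_prod_right' (Eventually.of_forall fun x => ?_)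
      rw [Real.norm_of_nonneg (integral_nonneg fun _ => norm_nonneg _)]
      simp only [Function.uncurry, norm_smul (φ x), integral_const_mul]
      gcongr
      exact (integrable_and_integral_norm_smul_le (q := q) Φ g x).2
    rw [← h1]
    simp only [← integral_smul]
    rw [integral_integral_swap hint]
    refine integral_congr_ae (Eventually.of_forall fun y => ?_)
    simp only [smul_eq_mul, ← integral_mul_const, Φ, mul_assoc]
  -- Under the integral `g` may be replaced by its representative, so the reproducing identity holds
  -- at every point.
  refine ⟨_, hG, hae, hB, fun x => integral_congr_ae ?_⟩
  filter_upwards [hae] with y hy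
  exact congrArg (fun z => Φ (x - y) • z) hy

end Fourier

/-! ### The uniform decomposition of unity -/

section UniformDecomp

variable {n : ℕ} {ρ : Rn n → ℝ}

lemma finite_norm_latticePoint_le (R : ℝ) : {k : Fin n → ℤ | ‖latticePoint k‖ ≤ R}.Finite := by
  refine (Set.finite_Icc (fun _ => -⌈R⌉ : Fin n → ℤ) fun _ => ⌈R⌉).subset fun k hk => ?_
  have h (i : Fin n) : |(k i : ℝ)| ≤ (⌈R⌉ : ℝ) :=
    ((PiLp.norm_apply_le (latticePoint k) i).trans hk).trans (Int.le_ceil R)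
  refine ⟨fun i => ?_, fun i => ?_⟩
  · exact_mod_cast (abs_le.1 (h i)).1
  · exact_mod_cast (abs_le.1 (h i)).2

lemma IsWindow.norm_le_of_ne_zero (hρ : IsWindow ρ) {v : Rn n} (hv : ρ v ≠ 0) : ‖v‖ ≤ √n := by
  rw [EuclideanSpace.norm_eq]
  refine Real.sqrt_le_sqrt ?_
  calc ∑ i, ‖v i‖ ^ 2 ≤ ∑ _ : Fin n, (1 : ℝ) := by
        refine Finset.sum_le_sum fun i _ => pow_le_one₀ (norm_nonneg _) ?_
        exact hρ.support_subset hv i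
    _ = n := by simp

lemma IsWindow.eq_zero_of_lt_norm (hρ : IsWindow ρ) {v : Rn n} (hv : √n < ‖v‖) : ρ v = 0 := by
  by_contra h
  exact (hρ.norm_le_of_ne_zero h).not_gt hv

lemma IsWindow.tsum_eq_sum (hρ : IsWindow ρ) {R : ℝ} {ξ : Rn n} (hξ : ‖ξ‖ ≤ R) :
    ∑' j : Fin n → ℤ, ρ (ξ - latticePoint j) =
      ∑ j ∈ (finite_norm_latticePoint_le (R + √n)).toFinset, ρ (ξ - latticePoint j) := by
  refine _root_.tsum_eq_sum fun j hj => hρ.eq_zero_of_lt_norm ?_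
  have h1 : R + √n < ‖latticePoint j‖ := by simpa using hj
  have h2 := norm_sub_norm_le (latticePoint j) ξ
  rw [norm_sub_rev] at h2
  linarith

lemma IsWindow.contDiff_tsum (hρ : IsWindow ρ) :
    ContDiff ℝ ∞ fun ξ : Rn n => ∑' j : Fin n → ℤ, ρ (ξ - latticePoint j) := by
  refine contDiff_iff_contDiffAt.2 fun ξ₀ => ?_
  have h1 : ContDiff ℝ ∞ fun ξ : Rn n =>
      ∑ j ∈ (finite_norm_latticePoint_le (‖ξ₀‖ + 1 + √n)).toFinset, ρ (ξ - latticePoint j) :=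
    ContDiff.sum fun j _ => hρ.contDiff.comp (contDiff_id.sub contDiff_const)
  refine h1.contDiffAt.congr_of_eventuallyEq ?_
  have hopen : IsOpen {ξ : Rn n | ‖ξ‖ < ‖ξ₀‖ + 1} := isOpen_lt continuous_norm continuous_const
  filter_upwards [hopen.mem_nhds (show ‖ξ₀‖ < ‖ξ₀‖ + 1 by linarith)] with ξ hξ
  exact hρ.tsum_eq_sum (le_of_lt hξ)

lemma IsWindow.tsum_pos (hρ : IsWindow ρ) (ξ : Rn n) :
    0 < ∑' j : Fin n → ℤ, ρ (ξ - latticePoint j) := by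
  -- The nearest lattice point leaves a remainder in `[-1/2,1/2]ⁿ`, where the window is `1`.
  have hone : ρ (ξ - latticePoint fun i => round (ξ i)) = 1 :=
    hρ.eq_one _ fun i => abs_sub_round (ξ i)
  rw [hρ.tsum_eq_sum le_rfl]
  refine Finset.sum_pos' (fun j _ => (hρ.mem_Icc _).1) ⟨fun i => round (ξ i), ?_, by simp [hone]⟩
  have h1 := hρ.norm_le_of_ne_zero (by rw [hone]; exact one_ne_zero)
  have h2 := norm_sub_norm_le (latticePoint fun i => round (ξ i)) ξ
  rw [norm_sub_rev] at h2
  simp only [Set.Finite.mem_toFinset, Set.mem_ofPred_eq]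
  linarith

lemma IsWindow.contDiff_uniformDecomp (hρ : IsWindow ρ) (k : Fin n → ℤ) :
    ContDiff ℝ ∞ (uniformDecomp ρ k) :=
  (hρ.contDiff.comp (contDiff_id.sub contDiff_const)).div hρ.contDiff_tsum
    fun ξ => (hρ.tsum_pos ξ).ne'

lemma IsWindow.uniformDecomp_eq_zero (hρ : IsWindow ρ) {k : Fin n → ℤ} {ξ : Rn n}
    (h : √n < ‖ξ - latticePoint k‖) : uniformDecomp ρ k ξ = 0 := by
  rw [uniformDecomp, hρ.eq_zero_of_lt_norm h, zero_div]

lemma IsWindow.sum_uniformDecomp (hρ : IsWindow ρ) {R : ℝ} {ξ : Rn n} (hξ : ‖ξ‖ ≤ R) :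
    ∑ k ∈ (finite_norm_latticePoint_le (R + √n)).toFinset, uniformDecomp ρ k ξ = 1 := by
  simp only [uniformDecomp]
  rw [← Finset.sum_div, ← hρ.tsum_eq_sum hξ, div_self (hρ.tsum_pos ξ).ne']

/-- The symbol of `□_k` in Mathlib's normalization of the Fourier transform. -/
def boxSymbol (ρ : Rn n → ℝ) (k : Fin n → ℤ) (ξ : Rn n) : ℂ :=
  (uniformDecomp ρ k ((2 * Real.pi) • ξ) : ℂ)

lemma norm_two_pi_smul (ξ : Rn n) : ‖(2 * Real.pi) • ξ‖ = 2 * Real.pi * ‖ξ‖ := by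
  rw [norm_smul, Real.norm_of_nonneg (by positivity)]

lemma IsWindow.boxSymbol_eq_zero (hρ : IsWindow ρ) {k : Fin n → ℤ} {ξ : Rn n}
    (h : √n < ‖(2 * Real.pi) • ξ - latticePoint k‖) : boxSymbol ρ k ξ = 0 := by
  rw [boxSymbol, hρ.uniformDecomp_eq_zero h, Complex.ofReal_zero]

lemma IsWindow.hasTemperateGrowth_boxSymbol (hρ : IsWindow ρ) (k : Fin n → ℤ) :
    (boxSymbol ρ k).HasTemperateGrowth := by
  refine HasCompactSupport.hasTemperateGrowth ?_ ?_
  · refine HasCompactSupport.of_support_subset_isCompact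
      (isCompact_closedBall (0 : Rn n) (‖latticePoint k‖ + √n)) fun ξ hξ => ?_
    have h1 : ‖(2 * Real.pi) • ξ - latticePoint k‖ ≤ √n := by
      by_contra h
      exact hξ (hρ.boxSymbol_eq_zero (not_le.1 h))
    have h2 := norm_sub_norm_le ((2 * Real.pi) • ξ) (latticePoint k)
    rw [norm_two_pi_smul] at h2
    rw [mem_closedBall_zero_iff]
    nlinarith [Real.pi_gt_three, norm_nonneg ξ]
  · exact Complex.ofRealCLM.contDiff.comp
      ((hρ.contDiff_uniformDecomp k).comp (contDiff_const_smul _))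

/-- A bounded piece of frequency space meets only finitely many of the symbols, which add up to
`1` there. -/
lemma IsWindow.exists_sum_smulLeftCLM_boxSymbol (hρ : IsWindow ρ) {ψ : 𝓢(Rn n, ℂ)}
    (hψ : HasCompactSupport ψ) : ∃ s : Finset (Fin n → ℤ),
      (∀ k, k ∉ s → SchwartzMap.smulLeftCLM ℂ (boxSymbol ρ k) ψ = 0) ∧
      ∑ k ∈ s, SchwartzMap.smulLeftCLM ℂ (boxSymbol ρ k) ψ = ψ := by
  obtain ⟨R, hR⟩ := hψ.isCompact.isBounded.exists_norm_le
  have hzero (ξ : Rn n) (h : 2 * Real.pi * R < ‖(2 * Real.pi) • ξ‖) : ψ ξ = 0 := by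
    refine image_eq_zero_of_notMem_tsupport fun hξ => h.not_ge ?_
    rw [norm_two_pi_smul]
    gcongr
    exact hR ξ hξ
  refine ⟨(finite_norm_latticePoint_le (2 * Real.pi * R + √n)).toFinset, fun k hk => ?_, ?_⟩
  · ext ξ
    rw [SchwartzMap.smulLeftCLM_apply_apply (hρ.hasTemperateGrowth_boxSymbol k)]
    rcases lt_or_ge (2 * Real.pi * R) ‖(2 * Real.pi) • ξ‖ with h | h
    · simp [hzero ξ h]
    · have h1 : 2 * Real.pi * R + √n < ‖latticePoint k‖ := by simpa using hk
      have h2 := norm_sub_norm_le (latticePoint k) ((2 * Real.pi) • ξ)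
      rw [norm_sub_rev] at h2
      rw [hρ.boxSymbol_eq_zero (by linarith), zero_smul, _root_.zero_apply]
  · ext ξ
    rw [_root_.sum_apply]
    simp only [SchwartzMap.smulLeftCLM_apply_apply (hρ.hasTemperateGrowth_boxSymbol _)]
    rw [← Finset.sum_smul]
    rcases lt_or_ge (2 * Real.pi * R) ‖(2 * Real.pi) • ξ‖ with h | h
    · simp [hzero ξ h]
    · have h1 := congrArg (fun x : ℝ => (x : ℂ)) (hρ.sum_uniformDecomp h)
      simp only [Complex.ofReal_sum, Complex.ofReal_one] at h1
      simp only [boxSymbol]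
      rw [h1, one_smul]

/-- There are smooth cutoffs, all translates of a single one, which are `1` on the supports of the
symbols of the operators `□_k`. -/
lemma IsWindow.exists_cutoff (hρ : IsWindow ρ) : ∃ χ : 𝓢(Rn n, ℂ), ∀ k : Fin n → ℤ,
    boxSymbol ρ k * SchwartzMap.compSubConstCLM ℂ ((2 * Real.pi)⁻¹ • latticePoint k) χ =
      boxSymbol ρ k := by
  -- The inner radius exceeds `√n`, the bound on the support of the window, so that it stays
  -- positive when `n = 0`.
  let β : ContDiffBump (0 : Rn n) := ⟨√n + 1, √n + 2, by positivity, by linarith⟩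
  have hpi : (2 * Real.pi) ≠ 0 := by positivity
  have hc : HasCompactSupport fun ξ : Rn n => (β ((2 * Real.pi) • ξ) : ℂ) :=
    (β.hasCompactSupport.comp_smul hpi).comp_left Complex.ofReal_zero
  have hs : ContDiff ℝ ∞ fun ξ : Rn n => (β ((2 * Real.pi) • ξ) : ℂ) :=
    Complex.ofRealCLM.contDiff.comp (β.contDiff.comp (contDiff_const_smul _))
  refine ⟨hc.toSchwartzMap hs, fun k => funext fun ξ => ?_⟩
  rw [Pi.mul_apply, SchwartzMap.compSubConstCLM_apply]
  change _ * (β ((2 * Real.pi) • (ξ - (2 * Real.pi)⁻¹ • latticePoint k)) : ℂ) = _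
  rw [smul_sub, smul_inv_smul₀ hpi]
  rcases lt_or_ge (√n) ‖(2 * Real.pi) • ξ - latticePoint k‖ with h | h
  · rw [hρ.boxSymbol_eq_zero h, zero_mul]
  · rw [β.one_of_mem_closedBall (by rw [mem_closedBall_zero_iff]; exact h.trans (by simp [β])),
      Complex.ofReal_one, mul_one]

end UniformDecomp

section Embedding

open FourierTransform

variable {n : ℕ} {p q : ENNReal} [Fact (1 ≤ p)] [Fact (1 ≤ q)] {ρ : Rn n → ℝ}

/-! ### The pieces of the decomposition -/

/-- The infimum is attained because an `L^p` function is determined by its distribution. -/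
lemma exists_toTemperedDistribution_eq_of_distLpNorm_lt_top {u : 𝓢'(Rn n, ℂ)}
    (hu : distLpNorm p u < ⊤) : ∃ g : Lp ℂ p (volume : Measure (Rn n)),
      Lp.toTemperedDistributionCLM ℂ volume p g = u ∧ ‖g‖ₑ ≤ distLpNorm p u := by
  obtain ⟨g, hg⟩ := iInf_lt_iff.1 hu
  obtain ⟨hg, -⟩ := iInf_lt_iff.1 hg
  refine ⟨g, hg, le_iInf₂ fun g' hg' => ?_⟩
  have h : Function.Injective
      (Lp.toTemperedDistributionCLM ℂ (volume : Measure (Rn n)) p).toLinearMap :=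
    LinearMap.ker_eq_bot.1 Lp.ker_toTemperedDistributionCLM_eq_bot
  rw [h (hg'.trans hg.symm)]

/-- Each single term of an `ℓ^q` norm is bounded by the norm, whatever `q`. -/
lemma ModulationSpace.exists_boxOp_eq {w : ℝ → ℝ} (f : ModulationSpace n p q w ρ)
    (k : Fin n → ℤ) : ∃ g : Lp ℂ p (volume : Measure (Rn n)),
      Lp.toTemperedDistributionCLM ℂ volume p g =
        boxOp ρ k (Lp.toTemperedDistributionCLM ℂ volume p f.toLp) ∧
      ‖g‖ ≤ Real.exp (-w ‖latticePoint k‖) * ‖f‖ := by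
  have hq : q ≠ 0 := (zero_lt_one.trans_le Fact.out).ne'
  have hf : modENorm q w ρ f.toLp < ⊤ := f.2
  have h1 : ENNReal.ofReal (Real.exp (w ‖latticePoint k‖)) *
      distLpNorm p (boxOp ρ k (Lp.toTemperedDistributionCLM ℂ volume p f.toLp)) ≤
      modENorm q w ρ f.toLp :=
    enorm_le_eLpNorm_count (fun k : Fin n → ℤ =>
      ENNReal.ofReal (Real.exp (w ‖latticePoint k‖)) *
        distLpNorm p (boxOp ρ k (Lp.toTemperedDistributionCLM ℂ volume p f.toLp))) k hq
  have hexp : ENNReal.ofReal (Real.exp (w ‖latticePoint k‖)) ≠ 0 := by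
    simpa using Real.exp_pos _
  have h2 : distLpNorm p (boxOp ρ k (Lp.toTemperedDistributionCLM ℂ volume p f.toLp)) < ⊤ := by
    refine lt_top_iff_ne_top.2 fun h => ?_
    rw [h, ENNReal.mul_top hexp] at h1
    exact hf.not_ge h1
  obtain ⟨g, hg, hle⟩ := exists_toTemperedDistribution_eq_of_distLpNorm_lt_top h2
  refine ⟨g, hg, ?_⟩
  have h3 : ENNReal.ofReal (Real.exp (w ‖latticePoint k‖)) * ‖g‖ₑ ≤ modENorm q w ρ f.toLp :=
    (mul_le_mul_right hle _).trans h1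
  have h4 := ENNReal.toReal_mono hf.ne h3
  rw [ENNReal.toReal_mul, ENNReal.toReal_ofReal (Real.exp_pos _).le, toReal_enorm,
    ← ModulationSpace.norm_def] at h4
  rw [Real.exp_neg, inv_mul_eq_div, le_div_iff₀ (Real.exp_pos _), mul_comm]
  exact h4

/-- The pieces `□_k f` of a function in a modulation space are smooth functions that satisfy
Bernstein's inequality. -/
lemma ModulationSpace.exists_smooth_boxOp (n : ℕ) (p q : ENNReal) [Fact (1 ≤ p)] [Fact (1 ≤ q)]
    (w : ℝ → ℝ) {ρ : Rn n → ℝ} (hρ : IsWindow ρ) :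
    ∃ A C : ℝ, 1 < A ∧ 0 ≤ C ∧ ∀ (f : ModulationSpace n p q w ρ) (k : Fin n → ℤ),
      ∃ G : Rn n → ℂ, ContDiff ℝ ∞ G ∧
        (∀ j x, ‖iteratedFDeriv ℝ j G x‖ ≤ (A * (1 + ‖latticePoint k‖)) ^ j *
          (C * (Real.exp (-w ‖latticePoint k‖) * ‖f‖))) ∧
        ∀ φ : 𝓢(Rn n, ℂ), ∫ x, φ x • G x =
          boxOp ρ k (Lp.toTemperedDistributionCLM ℂ volume p f.toLp) φ := by
  obtain ⟨χ, hχ⟩ := hρ.exists_cutoff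
  -- In `[0,∞]` this is the conjugate exponent also at the endpoints: `∞` for `p = 1` and `1` for `p
  -- = ∞`.
  let p' := (1 - p⁻¹)⁻¹
  have hpq : ENNReal.HolderConjugate p p' := ENNReal.HolderConjugate.inv_one_sub_inv' Fact.out
  have hqp : ENNReal.HolderConjugate p' p := hpq.symm
  let I := (∫ x, ‖(𝓕⁻ χ : 𝓢(Rn n, ℂ)) x‖) + ∫ x, ‖fderiv ℝ (𝓕⁻ χ : 𝓢(Rn n, ℂ)) x‖
  have hI₀ : 0 ≤ ∫ x, ‖(𝓕⁻ χ : 𝓢(Rn n, ℂ)) x‖ := integral_nonneg fun _ => norm_nonneg _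
  have hI₁ : 0 ≤ ∫ x, ‖fderiv ℝ (𝓕⁻ χ : 𝓢(Rn n, ℂ)) x‖ :=
    integral_nonneg fun _ => norm_nonneg _
  refine ⟨I + 2, (eLpNorm (𝓕⁻ χ : 𝓢(Rn n, ℂ)) p' volume).toReal, by linarith,
    ENNReal.toReal_nonneg, fun f k => ?_⟩
  obtain ⟨g, hg, hgn⟩ := f.exists_boxOp_eq k
  let χk := SchwartzMap.compSubConstCLM ℂ ((2 * Real.pi)⁻¹ • latticePoint k) χ
  have hmul : TemperedDistribution.fourierMultiplierCLM ℂ χk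
      (Lp.toTemperedDistributionCLM ℂ volume p g) =
      Lp.toTemperedDistributionCLM ℂ volume p g := by
    rw [hg]
    refine (TemperedDistribution.fourierMultiplierCLM_fourierMultiplierCLM_apply
      (hρ.hasTemperateGrowth_boxSymbol k) χk.hasTemperateGrowth _).trans ?_
    rw [hχ k]
    rfl
  obtain ⟨G, hG, hgG, hB, hrep⟩ :=
    exists_reproducing_of_fourierMultiplier_eq (q := p') χk g hmul
  -- Modulation leaves the modulus of the kernel unchanged, so the Hölder constant is the same for
  -- every `k`.
  have hker : eLpNorm (𝓕⁻ χk : 𝓢(Rn n, ℂ)) p' volume =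
      eLpNorm (𝓕⁻ χ : 𝓢(Rn n, ℂ)) p' volume :=
    eLpNorm_congr_norm_ae (Eventually.of_forall fun x => norm_fourierInv_compSubConstCLM χ _ x)
  have hB' (x : Rn n) : ‖G x‖ ≤ (eLpNorm (𝓕⁻ χ : 𝓢(Rn n, ℂ)) p' volume).toReal *
      (Real.exp (-w ‖latticePoint k‖) * ‖f‖) := by
    refine (hB x).trans ?_
    rw [hker]
    gcongr
  have hA : ∫ y, ‖fderiv ℝ (𝓕⁻ χk : 𝓢(Rn n, ℂ)) y‖ ≤ (I + 2) * (1 + ‖latticePoint k‖) := by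
    refine (integral_norm_fderiv_fourierInv_compSubConstCLM_le χ _).trans ?_
    -- The centre of the cutoff is `k/(2π)`, and this cancels the `2π` from differentiating the
    -- character.
    rw [norm_smul, Real.norm_of_nonneg (by positivity), ← mul_assoc,
      mul_inv_cancel₀ (by positivity), one_mul]
    have := norm_nonneg (latticePoint k)
    nlinarith [mul_nonneg this hI₁]
  have hbern (j : ℕ) := contDiff_and_norm_iteratedFDeriv_le_of_reproducing (𝓕⁻ χk) j hG hB' hrep
  refine ⟨G, contDiff_infty.2 fun j => (hbern j).1, fun j x => ((hbern j).2 x).trans ?_,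
    fun φ => ?_⟩
  · have h0 : 0 ≤ ∫ y, ‖fderiv ℝ (𝓕⁻ χk : 𝓢(Rn n, ℂ)) y‖ :=
      integral_nonneg fun _ => norm_nonneg _
    have := (norm_nonneg _).trans (hB' x)
    gcongr
  · rw [← hg, Lp.toTemperedDistributionCLM_apply, Lp.toTemperedDistribution_apply]
    refine integral_congr_ae ?_
    filter_upwards [hgG] with x hx
    rw [hx]

/-! ### Summation of the pieces -/

/-- A bounded function that agrees with `f ∈ L^p` when tested against the Schwartz functions with
compactly supported Fourier transform agrees with `f` almost everywhere. -/
lemma ae_eq_of_forall_integral_fourier (f : Lp ℂ p (volume : Measure (Rn n))) {F : Rn n → ℂ}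
    (hF : MemLp F ⊤ volume)
    (h : ∀ ψ : 𝓢(Rn n, ℂ), HasCompactSupport ψ →
      ∫ x, 𝓕 ψ x • F x = Lp.toTemperedDistributionCLM ℂ volume p f (𝓕 ψ)) :
    F =ᵐ[volume] f := by
  have hcong (φ : 𝓢(Rn n, ℂ)) :
      Lp.toTemperedDistributionCLM ℂ volume ⊤ (hF.toLp F) φ = ∫ x, φ x • F x := by
    rw [Lp.toTemperedDistributionCLM_apply, Lp.toTemperedDistribution_apply]
    refine integral_congr_ae ?_
    filter_upwards [hF.coeFn_toLp] with x hx
    rw [hx]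
  refine ae_eq_of_forall_integral_schwartz (hF.locallyIntegrable le_top)
    ((Lp.memLp f).locallyIntegrable Fact.out) fun φ => ?_
  rw [← hcong, ← Lp.toTemperedDistribution_apply, ← Lp.toTemperedDistributionCLM_apply]
  -- Approximating `𝓕⁻ φ` by compactly supported functions and applying `𝓕` approximates `φ` by
  -- admissible test functions; both pairings are continuous on `𝓢`.
  obtain ⟨s, hs, hlim⟩ := exists_tendsto_hasCompactSupport (𝓕⁻ φ : 𝓢(Rn n, ℂ))
  have hlim' : Tendsto (fun N => 𝓕 (s N)) atTop (𝓝 φ) := by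
    have := ((fourierCLM ℂ 𝓢(Rn n, ℂ)).continuous.tendsto (𝓕⁻ φ)).comp hlim
    simpa [Function.comp_def] using this
  have h1 := ((Lp.toTemperedDistributionCLM ℂ volume ⊤ (hF.toLp F)).continuous.tendsto φ).comp
    hlim'
  have h2 := ((Lp.toTemperedDistributionCLM ℂ volume p f).continuous.tendsto φ).comp hlim'
  refine tendsto_nhds_unique h1 (h2.congr fun N => ?_)
  exact (h _ (hs N)).symm.trans (hcong _).symm

/-- The functions in a modulation space are ultradifferentiable, with global and uniform
bounds for the derivatives. -/
lemma ModulationSpace.exists_ultradifferentiable (n : ℕ) (p q : ENNReal) [Fact (1 ≤ p)]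
    [Fact (1 ≤ q)] {w : ℝ → ℝ} (hw : IsAdmissibleWeight w) {ρ : Rn n → ℝ} (hρ : IsWindow ρ) :
    ∃ (m : ℕ+) (C : ℝ), 0 ≤ C ∧ ∀ f : ModulationSpace n p q w ρ,
      ∃ F : Rn n → ℂ, ContDiff ℝ ∞ F ∧ F =ᵐ[volume] f.toLp ∧
        ∀ (j : ℕ) x, ‖iteratedFDeriv ℝ j F x‖ ≤
          C * ‖f‖ * Real.exp (1 / (m : ℝ) * youngConj w (m * j)) := by
  obtain ⟨A, C, hA, hC, hbox⟩ := ModulationSpace.exists_smooth_boxOp n p q w hρ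
  obtain ⟨m, D, hD, hm⟩ := hw.exists_pow_mul_exp_neg_le hA
  have hsum := hw.summable_exp_neg n
  let S := ∑' k : Fin n → ℤ, Real.exp (-(w ‖latticePoint k‖ / 2))
  have hS : 0 ≤ S := tsum_nonneg fun _ => (Real.exp_pos _).le
  refine ⟨m, C * D * S, by positivity, fun f => ?_⟩
  choose G hG hGb hGφ using hbox f
  -- A majorant independent of `x`: its summability justifies termwise differentiation, and its sum
  -- is the final bound.
  let v (j : ℕ) (k : Fin n → ℤ) : ℝ :=
    C * D * ‖f‖ * Real.exp (1 / (m : ℝ) * youngConj w (m * j)) *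
      Real.exp (-(w ‖latticePoint k‖ / 2))
  have hv (j : ℕ) : Summable (v j) := hsum.mul_left _
  have hvb (j : ℕ) (k : Fin n → ℤ) (x : Rn n) : ‖iteratedFDeriv ℝ j (G k) x‖ ≤ v j k := by
    refine (hGb k j x).trans ?_
    calc _ = C * ‖f‖ * ((A * (1 + ‖latticePoint k‖)) ^ j *
            Real.exp (-w ‖latticePoint k‖)) := by ring
      _ ≤ C * ‖f‖ * (D * Real.exp (-(w ‖latticePoint k‖ / 2)) *
            Real.exp (1 / (m : ℝ) * youngConj w (m * j))) :=
          mul_le_mul_of_nonneg_left (hm ‖latticePoint k‖ (norm_nonneg _) j) (by positivity)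
      _ = v j k := by ring
  let F : Rn n → ℂ := fun x => ∑' k, G k x
  have hF : ContDiff ℝ ∞ F := contDiff_tsum (v := v) hG (fun j _ => hv j) fun j k x _ => hvb j k x
  have hFb (j : ℕ) (x : Rn n) : ‖iteratedFDeriv ℝ j F x‖ ≤
      C * D * S * ‖f‖ * Real.exp (1 / (m : ℝ) * youngConj w (m * j)) := by
    have h1 : iteratedFDeriv ℝ j F x = ∑' k, iteratedFDeriv ℝ j (G k) x :=
      iteratedFDeriv_tsum_apply (N := ⊤) (v := v) hG (fun j _ => hv j)
        (fun j k x _ => hvb j k x) le_top x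
    rw [h1]
    refine (tsum_of_norm_bounded (hv j).hasSum fun k => hvb j k x).trans_eq ?_
    simp only [v, tsum_mul_left, S]
    ring
  refine ⟨F, hF, ?_, hFb⟩
  have hG0 (k : Fin n → ℤ) (x : Rn n) : ‖G k x‖ ≤ v 0 k := by simpa using hvb 0 k x
  have hF0 : MemLp F ⊤ volume :=
    memLp_top_of_bound hF.continuous.aestronglyMeasurable _
      (Eventually.of_forall fun x => by simpa using hFb 0 x)
  refine ae_eq_of_forall_integral_fourier f.toLp hF0 fun ψ hψ => ?_
  obtain ⟨s, hs0, hs1⟩ := hρ.exists_sum_smulLeftCLM_boxSymbol hψ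
  have hterm (k : Fin n → ℤ) : ∫ x, 𝓕 ψ x • G k x =
      Lp.toTemperedDistributionCLM ℂ volume p f.toLp
        (𝓕 (SchwartzMap.smulLeftCLM ℂ (boxSymbol ρ k) ψ)) := by
    rw [hGφ]
    change Lp.toTemperedDistributionCLM ℂ volume p f.toLp
        (𝓕 (SchwartzMap.smulLeftCLM ℂ (boxSymbol ρ k) (𝓕⁻ (𝓕 ψ)))) = _
    rw [fourierInv_fourier_eq]
  have hint (k : Fin n → ℤ) : Integrable fun x => 𝓕 ψ x • G k x :=
    Integrable.smul_bdd (𝓕 ψ : 𝓢(Rn n, ℂ)).integrable (v 0 k)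
      (hG k).continuous.aestronglyMeasurable (Eventually.of_forall (hG0 k))
  have hnorm (k : Fin n → ℤ) : ∫ x, ‖𝓕 ψ x • G k x‖ ≤ (∫ x, ‖𝓕 ψ x‖) * v 0 k := by
    rw [← integral_mul_const]
    refine integral_mono (hint k).norm ((𝓕 ψ : 𝓢(Rn n, ℂ)).integrable.norm.mul_const _)
      fun x => ?_
    rw [norm_smul]
    gcongr
    exact hG0 k x
  have htsum : ∑' k, ∫ x, 𝓕 ψ x • G k x = ∫ x, ∑' k, 𝓕 ψ x • G k x :=
    integral_tsum_of_summable_integral_norm hint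
      (((hv 0).mul_left _).of_nonneg_of_le (fun k => integral_nonneg fun _ => norm_nonneg _) hnorm)
  have hpt (x : Rn n) : ∑' k, 𝓕 ψ x • G k x = 𝓕 ψ x • F x :=
    ((hv 0).of_norm_bounded fun k => hG0 k x).tsum_const_smul _
  simp only [hpt] at htsum
  -- Outside `s` the symbol kills `ψ`, so the series is a finite sum, and over `s` the pieces of `ψ`
  -- add up to `ψ`.
  rw [← htsum, tsum_eq_sum (s := s) fun k hk => by rw [hterm, hs0 k hk]; simp]
  simp only [hterm]
  rw [← map_sum]
  congr 1
  conv_rhs => rw [← hs1]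
  exact (map_sum (fourierCLM ℂ 𝓢(Rn n, ℂ)) _ _).symm

/-! ### The embedding -/

lemma norm_multiDeriv_le (α : Fin n → ℕ) (F : Rn n → ℂ) (x : Rn n) :
    ‖multiDeriv α F x‖ ≤ ‖iteratedFDeriv ℝ (∑ i, α i) F x‖ := by
  refine (ContinuousMultilinearMap.le_opNorm _ _).trans (le_of_eq ?_)
  simp

lemma roumieuENorm_le {w : ℝ → ℝ} {K : Compacts (Rn n)} {m : ℕ+} {F : Rn n → ℂ} {C : ℝ}
    (h : ∀ (j : ℕ) x, ‖iteratedFDeriv ℝ j F x‖ ≤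
      C * Real.exp (1 / (m : ℝ) * youngConj w (m * j))) :
    roumieuENorm w K m F ≤ ENNReal.ofReal C := by
  refine iSup₂_le fun x _ => iSup_le fun α => ENNReal.ofReal_le_ofReal ?_
  rw [div_le_iff₀ (Real.exp_pos _)]
  exact (norm_multiDeriv_le α F x).trans (h _ x)

lemma RoumieuStep.norm_def {w : AdmissibleWeight} {K : Compacts (Rn n)} {m : ℕ+}
    (f : RoumieuStep n w K m) : ‖f‖ = (roumieuENorm w.1 K m f.1).toReal := rfl

lemma continuous_RoumieuStep_toLocal (w : AdmissibleWeight) (K : Compacts (Rn n)) (m : ℕ+) :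
    Continuous (RoumieuStep.toLocal : RoumieuStep n w K m → RoumieuLocal n w K) :=
  continuous_sInf_rng.2 fun _ ht => ht.1 m

/-- A linear map from a normed space to `𝓔_{w}(ℝⁿ)` is continuous if it is bounded into
one and the same step over every compact set. -/
lemma RoumieuSpace.continuous_of_bound {E : Type*} [SeminormedAddCommGroup E] [Module ℂ E]
    {w : AdmissibleWeight} (T : E →ₗ[ℂ] RoumieuSpace n w) (m : ℕ+) {C : ℝ} (hC : 0 ≤ C)
    (h : ∀ f K, roumieuENorm w.1 K m (T f).1 ≤ ENNReal.ofReal (C * ‖f‖)) : Continuous T := by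
  refine continuous_iInf_rng.2 fun K => continuous_induced_rng.2 ?_
  -- Over each compact set the map factors through the single step `m`, where boundedness means
  -- continuity.
  let S : E →+ RoumieuStep n w K m :=
    { toFun := fun f => ⟨(T f).1, (T f).2.1, (h f K).trans_lt ENNReal.ofReal_lt_top⟩
      map_zero' := Subtype.ext (by change (T 0).1 = _; rw [map_zero]; rfl)
      map_add' := fun f g => Subtype.ext (by change (T (f + g)).1 = _; rw [map_add]; rfl) }
  have hS : Continuous S := by
    refine AddMonoidHomClass.continuous_of_bound S C fun f => ?_
    rw [RoumieuStep.norm_def]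
    exact ENNReal.toReal_le_of_le_ofReal (by positivity) (h f K)
  exact (continuous_RoumieuStep_toLocal w K m).comp hS

end Embedding

end UltraModulation

end

theorem mainTheorem9 (n : ℕ) (p q : ENNReal) [Fact (1 ≤ p)] [Fact (1 ≤ q)]
    (w : UltraModulation.AdmissibleWeight)
    (ρ : UltraModulation.Rn n → ℝ) (hρ : UltraModulation.IsWindow ρ) :
    ∃ ι : UltraModulation.ModulationSpace n p q w.1 ρ →L[ℂ] UltraModulation.RoumieuSpace n w,
      Function.Injective ι ∧
      ∀ f : UltraModulation.ModulationSpace n p q w.1 ρ,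
        (ι f : UltraModulation.Rn n → ℂ) =ᵐ[MeasureTheory.volume] f.toLp := by
  obtain ⟨m, C, hC, h⟩ :=
    UltraModulation.ModulationSpace.exists_ultradifferentiable n p q w.2 hρ
  choose F hF hae hb using h
  -- The functions `F f` were merely chosen; uniqueness of continuous representatives makes the
  -- choice linear in `f`.
  have huniq {G₁ G₂ : UltraModulation.Rn n → ℂ} (h₁ : Continuous G₁) (h₂ : Continuous G₂)
      (hG : G₁ =ᵐ[volume] G₂) : G₁ = G₂ := (Continuous.ae_eq_iff_eq volume h₁ h₂).1 hG
  let T : UltraModulation.ModulationSpace n p q w.1 ρ →ₗ[ℂ] UltraModulation.RoumieuSpace n w :=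
    { toFun := fun f => ⟨F f, hF f, fun K =>
        ⟨m, (UltraModulation.roumieuENorm_le (hb f)).trans_lt ENNReal.ofReal_lt_top⟩⟩
      map_add' := fun f g => Subtype.ext <| by
        refine huniq (hF _).continuous ((hF f).continuous.add (hF g).continuous) ?_
        exact (hae _).trans ((Lp.coeFn_add f.toLp g.toLp).trans ((hae f).add (hae g)).symm)
      map_smul' := fun c f => Subtype.ext <| by
        refine huniq (hF _).continuous ((hF f).continuous.const_smul c) ?_
        exact (hae _).trans ((Lp.coeFn_smul c f.toLp).trans ((hae f).const_smul c).symm) }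
  refine ⟨⟨T, UltraModulation.RoumieuSpace.continuous_of_bound T m hC fun f K =>
    UltraModulation.roumieuENorm_le (hb f)⟩, fun f g hfg => ?_, hae⟩
  have hFfg : F f = F g := congrArg Subtype.val hfg
  have htoLp : f.toLp = g.toLp := Lp.ext ((hae f).symm.trans (by rw [hFfg]; exact hae g))
  exact Subtype.ext htoLp
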